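/- **Proposition.** Let $X$ be a connected finite simplicial complex, $x_0\in |X|$, and $\nu\colon \pi_1(|X|,x_0)\twoheadrightarrow \mathbb{Z}$ a group epimorphism. Let $\mathbb{K}$ be a field, $R=\mathbb{K}[t^{\pm1}]$ and $s=t-1$. Let $\mathcal{L}^\nu$ be the local system of $R$-modules on $|X|$ with stalk $R$ in which transport along a loop $\gamma$ is multiplication by $t^{\nu(\gamma)}$. Triangulate $S^1=\mathbb{R}/\mathbb{Z}$, for some $N\ge 3$, by the vertices $x_j=j/N$ $(0\le j\le N-1)$ and the edges $[x_j,x_{j+1}]$ (indices mod $N$), and let $f\colon |X|\to S^1$ be a simplicial map inducing $\nu$ (that is, $\nu(\gamma)$ is the winding number of $f\circ\gamma$). Order the vertices of each simplex of $X$ compatibly with passing to faces, and choose an order of the two ends of each edge of $S^1$, in such a way that $f$ is weakly order preserving on every simplex. Let $\eta_0$ be the simplicial $1$-cochain on $S^1$ that is $1$ on the edge $[x_{N-1},x_0]$ directed from $x_{N-1}$ to $x_0$ (so $-1$ on it in the other direction) and $0$ on all other edges, and let $\eta=f^*\eta_0\in C^1(X)$. Here $C_*(X)$ and $C^*(X)$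 are the simplicial chains and cochains over $\mathbb{K}$ formed with ordered simplices $\langle v_0,\dots,v_k\rangle$, and $$\langle v_0,\dots,v_k\rangle\cap\eta=\eta(\langle v_0,v_1\rangle)\langle v_1,\dots,v_k\rangle,\qquad (\eta\cup\beta)(\langle v_0,\dots,v_k\rangle)=\eta(\langle v_0,v_1\rangle)\,\beta(\langle v_1,\dots,v_k\rangle).$$ The (co)homology $H_i(X,-)$, $H^i(X,-)$ with coefficients in a local system is the simplicial one. 1. $(\partial+s(-\cap\eta))^2=0$ on $C_*(X)\otimes_{\mathbb{K}}R$. In particular, for every $m>0$, $C_*(X,\eta,m)=(C_*(X)\otimes_{\mathbb{K}} R/(s^{m+1}),\ \partial+s(-\cap\eta))$ is a chain complex. 2. For every $m>0$ and $i\ge 0$ there is an isomorphism of $R/(s^{m+1})$-modules $$H_i\big(X,\mathcal{L}^\nu\otimes_R R/(s^{m+1})\big)\cong H_i\big(C_*(X,\eta,m)\big).$$ 3. For every $m>0$, $C^*(X,\eta,m)=(C^*(X)\otimes_{\mathbb{K}} R/(s^{m+1}),\ \delta+(\eta\cup-)\otimes s)$ is a cochain complex, and for every $i\ge0$ there is an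 isomorphism of $R/(s^{m+1})$-modules $$H^i\big(X,\mathcal{L}^\nu\otimes_R R/(s^{m+1})\big)\cong H^i\big(C^*(X,\eta,m)\big).$$ 4. Let $\widehat R=\varprojlim_m R/(s^{m+1})=\mathbb{K}[[s]]$, with $R\to\widehat R$, $t\mapsto 1+s$. Then $C^*(X,\eta,\infty)=(C^*(X)\otimes_{\mathbb{K}}\widehat R,\ \delta+(\eta\cup-)\otimes s)$ is a cochain complex, and for every $i\ge 0$ there is an isomorphism of $\widehat R$-modules $$H^i\big(X,\mathcal{L}^\nu\otimes_R\widehat R\big)\cong H^i\big(C^*(X,\eta,\infty)\big).$$ -/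

import Mathlib

open CategoryTheory TensorProduct
open scoped DirectSum LaurentPolynomial

universe u v w

noncomputable section

namespace TwistedComplex

/-! ### Finite simplicial complexes: realization, straight edges, ordered simplices -/

section Simplicial

variable {V : Type u} [Fintype V]

/-- The geometric realization `|X|` of a finite abstract simplicial complex, in barycentric
coordinates, with the topology induced from `V → ℝ`. -/
def Realization (X : AbstractSimplicialComplex V) : Type u :=
  {x : V → ℝ // (∀ v, 0 ≤ x v) ∧ ∑ v, x v = 1 ∧ ∃ σ ∈ X.faces, ∀ v, x v ≠ 0 → v ∈ σ}

instance (X : AbstractSimplicialComplex V) : TopologicalSpace (Realization X) :=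
  inferInstanceAs (TopologicalSpace {_x : V → ℝ // _})

variable (X : AbstractSimplicialComplex V)

open Classical in
/-- The point of `|X|` given by a vertex. -/
def vertex (a : V) : Realization X :=
  ⟨Pi.single a 1, by
    refine ⟨fun v => ?_, by simp, {a}, X.singleton_mem a, fun v hv => ?_⟩
    · by_cases h : v = a
      · subst h; simp
      · simp [h]
    · by_contra h
      simp at h
      simp [h] at hv⟩

open Classical in
/-- The straight path `t ↦ (1 - t) a + t b` in `|X|` between two vertices `a`, `b` of a common
simplex. -/
def segment {a b : V} (h : ∃ σ ∈ X.faces, a ∈ σ ∧ b ∈ σ) : Path (vertex X a) (vertex X b) where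
  toFun t := ⟨fun v => (1 - (t : ℝ)) * (Pi.single a 1 : V → ℝ) v + t * (Pi.single b 1 : V → ℝ) v, by
    have h0 : ∀ c v : V, 0 ≤ (Pi.single c 1 : V → ℝ) v := fun c v => (vertex X c).2.1 v
    obtain ⟨σ, hσ, ha, hb⟩ := h
    refine ⟨fun v => ?_, ?_, σ, hσ, fun v hv => ?_⟩
    · have h1 := t.2.1
      have h2 : 0 ≤ 1 - (t : ℝ) := sub_nonneg.2 t.2.2
      have h3 := h0 a v
      have h4 := h0 b v
      positivity
    · simp [Finset.sum_add_distrib, ← Finset.mul_sum]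
    · by_contra hc
      have h1 : v ≠ a := fun e => hc (e ▸ ha)
      have h2 : v ≠ b := fun e => hc (e ▸ hb)
      simp [h1, h2] at hv⟩
  continuous_toFun := by
    refine Continuous.subtype_mk ?_ _
    fun_prop
  source' := by
    apply Subtype.ext
    funext v
    simp [vertex]
  target' := by
    apply Subtype.ext
    funext v
    simp [vertex]

/-- A relation on the vertices that restricts to a strict total order on every simplex. -/
structure IsVertexOrder (o : V → V → Prop) : Prop where
  asymm : ∀ σ ∈ X.faces, ∀ a ∈ σ, ∀ b ∈ σ, o a b → ¬ o b a
  trans : ∀ σ ∈ X.faces, ∀ a ∈ σ, ∀ b ∈ σ, ∀ c ∈ σ, o a b → o b c → o a c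
  total : ∀ σ ∈ X.faces, ∀ a ∈ σ, ∀ b ∈ σ, a ≠ b → o a b ∨ o b a

/-- The `k`-simplices `⟨v₀, …, v_k⟩` of `X`, with vertices listed in increasing order. -/
def Simplex (o : V → V → Prop) (k : ℕ) : Type u :=
  {s : Fin (k + 1) → V // (∃ σ ∈ X.faces, ∀ i, s i ∈ σ) ∧ ∀ i j, i < j → o (s i) (s j)}

variable {X} {o : V → V → Prop}

/-- The face `⟨v₀, …, v̂ᵢ, …, v_{k+1}⟩`. -/
def Simplex.face {k : ℕ} (i : Fin (k + 2)) (s : Simplex X o (k + 1)) : Simplex X o k :=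
  ⟨fun j => s.1 (i.succAbove j),
    ⟨s.2.1.imp fun _ h => ⟨h.1, fun _ => h.2 _⟩,
      fun _ _ hab => s.2.2 _ _ (Fin.strictMono_succAbove i hab)⟩⟩

/-- The front face `⟨v₀, …, v_p⟩` of a `(q + p)`-simplex. -/
def Simplex.front {q p : ℕ} (s : Simplex X o (q + p)) : Simplex X o p :=
  ⟨fun j => s.1 ⟨j, by omega⟩,
    ⟨s.2.1.imp fun _ h => ⟨h.1, fun _ => h.2 _⟩, fun _ _ hab => s.2.2 _ _ hab⟩⟩

/-- The back face `⟨v_p, …, v_{q+p}⟩` of a `(q + p)`-simplex. -/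
def Simplex.back {q p : ℕ} (s : Simplex X o (q + p)) : Simplex X o q :=
  ⟨fun j => s.1 ⟨j + p, by omega⟩,
    ⟨s.2.1.imp fun _ h => ⟨h.1, fun _ => h.2 _⟩,
      fun _ _ hab => s.2.2 _ _ (by simpa using hab)⟩⟩

/-- The straight path from the first vertex of a simplex to the first vertex of its `i`-th face
(it is constant unless `i = 0`). -/
def Simplex.segToFace {k : ℕ} (i : Fin (k + 2)) (s : Simplex X o (k + 1)) :
    Path (vertex X (s.1 0)) (vertex X ((s.face i).1 0)) :=
  segment X (s.2.1.imp fun _ h => ⟨h.1, h.2 _, h.2 _⟩)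

end Simplicial

/-! ### Homology of a pair (cycles, boundaries) -/

/-- `Z / (B ∩ Z)`; this is the homology `Z / B` when `B ≤ Z`. -/
abbrev Subquotient {A : Type v} [CommRing A] {M : Type w} [AddCommGroup M] [Module A M]
    (Z B : Submodule A M) : Type w :=
  Z ⧸ B.submoduleOf Z

/-! ### Simplicial chains and cochains with coefficients in a field -/

section Chains

variable {V : Type u} [Fintype V] (X : AbstractSimplicialComplex V) (o : V → V → Prop)
variable (K : Type v) [Field K]

/-- The simplicial chains `C_k(X)` over `K`. -/
abbrev Chain (k : ℕ) : Type (max u v) := Simplex X o k →₀ K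

/-- The simplicial cochains `C^k(X)` over `K`. -/
abbrev Cochain (k : ℕ) : Type (max u v) := Simplex X o k → K

/-- The boundary `∂ : C_{k+1}(X) → C_k(X)`. -/
def boundary (k : ℕ) : Chain X o K (k + 1) →ₗ[K] Chain X o K k :=
  Finsupp.linearCombination K fun s =>
    ∑ i : Fin (k + 2), (-1 : K) ^ (i : ℕ) • Finsupp.single (s.face i) (1 : K)

/-- The coboundary `δ : C^k(X) → C^{k+1}(X)`, the transpose of `∂`. -/
def coboundary (k : ℕ) : Cochain X o K k →ₗ[K] Cochain X o K (k + 1) :=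
  LinearMap.pi fun s =>
    ∑ i : Fin (k + 2), (-1 : K) ^ (i : ℕ) • LinearMap.proj (s.face i)

variable {X o K}

/-- The cap product `⟨v₀, …, v_{q+p}⟩ ∩ α = α(⟨v₀, …, v_p⟩) ⟨v_p, …, v_{q+p}⟩`. -/
def cap {p : ℕ} (α : Cochain X o K p) (q : ℕ) : Chain X o K (q + p) →ₗ[K] Chain X o K q :=
  Finsupp.linearCombination K fun s => Finsupp.single s.back (α s.front)

/-- The left cup product
`(α ∪ β)(⟨v₀, …, v_{p+q}⟩) = α(⟨v₀, …, v_p⟩) β(⟨v_p, …, v_{p+q}⟩)` as a map in `β`. -/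
def cup {p : ℕ} (α : Cochain X o K p) (q : ℕ) : Cochain X o K q →ₗ[K] Cochain X o K (q + p) :=
  LinearMap.pi fun s => α s.front • LinearMap.proj s.back

variable (η : Cochain X o K 1) (A : Type v) [CommRing A] [Algebra K A] (s : A)

/-- `∂ + s (- ∩ η)` on `C_*(X) ⊗ A`, from degree `k + 1` to degree `k`. -/
def twistedBoundary (k : ℕ) : A ⊗[K] Chain X o K (k + 1) →ₗ[A] A ⊗[K] Chain X o K k :=
  (boundary X o K k).baseChange A + s • (cap η k).baseChange A

/-- `δ + (η ∪ -) ⊗ s` on `C^*(X) ⊗ A`, from degree `k` to degree `k + 1`. -/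
def twistedCoboundary (k : ℕ) : A ⊗[K] Cochain X o K k →ₗ[A] A ⊗[K] Cochain X o K (k + 1) :=
  (coboundary X o K k).baseChange A + s • (cup η k).baseChange A

/-- Cycles of `(C_*(X) ⊗ A, ∂ + s (- ∩ η))`. -/
def twistedCycles : (k : ℕ) → Submodule A (A ⊗[K] Chain X o K k)
  | 0 => ⊤
  | k + 1 => LinearMap.ker (twistedBoundary η A s k)

/-- The homology `H_i (C_*(X) ⊗ A, ∂ + s (- ∩ η))`. -/
def TwistedHomology (i : ℕ) : Type (max u v) :=
  Subquotient (twistedCycles η A s i) (LinearMap.range (twistedBoundary η A s i))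

instance (i : ℕ) : AddCommGroup (TwistedHomology η A s i) :=
  inferInstanceAs (AddCommGroup (Subquotient (twistedCycles η A s i) (LinearMap.range (twistedBoundary η A s i))))

instance (i : ℕ) : Module A (TwistedHomology η A s i) :=
  inferInstanceAs (Module A (Subquotient (twistedCycles η A s i) (LinearMap.range (twistedBoundary η A s i))))

/-- Coboundaries of `(C^*(X) ⊗ A, δ + (η ∪ -) ⊗ s)`. -/
def twistedCoboundaries : (k : ℕ) → Submodule A (A ⊗[K] Cochain X o K k)
  | 0 => ⊥
  | k + 1 => LinearMap.range (twistedCoboundary η A s k)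

/-- The cohomology `H^i (C^*(X) ⊗ A, δ + (η ∪ -) ⊗ s)`. -/
def TwistedCohomology (i : ℕ) : Type (max u v) :=
  Subquotient (LinearMap.ker (twistedCoboundary η A s i)) (twistedCoboundaries η A s i)

instance (i : ℕ) : AddCommGroup (TwistedCohomology η A s i) :=
  inferInstanceAs (AddCommGroup (Subquotient (LinearMap.ker (twistedCoboundary η A s i)) (twistedCoboundaries η A s i)))

instance (i : ℕ) : Module A (TwistedCohomology η A s i) :=
  inferInstanceAs (Module A (Subquotient (LinearMap.ker (twistedCoboundary η A s i)) (twistedCoboundaries η A s i)))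

end Chains

/-! ### Local systems and simplicial (co)homology with local coefficients -/

/-- A local system of `A`-modules on a space: a functor on its fundamental groupoid. -/
abbrev LocalSystem (A : Type v) [CommRing A] (Y : Type u) [TopologicalSpace Y] :=
  FundamentalGroupoid Y ⥤ ModuleCat.{w} A

section LocalCoefficients

variable {V : Type u} [Fintype V] (X : AbstractSimplicialComplex V) (o : V → V → Prop)
variable {A : Type v} [CommRing A] (F : LocalSystem.{u, v, w} A (Realization X))

/-- The stalk of a local system at the first vertex of a simplex. -/
abbrev stalk {k : ℕ} (s : Simplex X o k) : ModuleCat.{w} A :=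
  F.obj ⟨vertex X (s.1 0)⟩

/-- Transport from the first vertex of a simplex to the first vertex of its `i`-th face. -/
def transport {k : ℕ} (i : Fin (k + 2)) (s : Simplex X o (k + 1)) :
    stalk X o F s →ₗ[A] stalk X o F (s.face i) :=
  (F.map (X := ⟨vertex X (s.1 0)⟩) (Y := ⟨vertex X ((s.face i).1 0)⟩)
    (Path.Homotopic.Quotient.mk (s.segToFace i))).hom

/-- Transport from the first vertex of the `i`-th face of a simplex to its first vertex. -/
def transportBack {k : ℕ} (i : Fin (k + 2)) (s : Simplex X o (k + 1)) :
    stalk X o F (s.face i) →ₗ[A] stalk X o F s :=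
  (F.map (X := ⟨vertex X ((s.face i).1 0)⟩) (Y := ⟨vertex X (s.1 0)⟩)
    (Path.Homotopic.Quotient.mk (s.segToFace i).symm)).hom

/-- Simplicial `k`-chains with local coefficients: finite sums of terms `a ⟨v₀, …, v_k⟩` with `a`
in the stalk at `v₀`. -/
abbrev LocalChain (k : ℕ) : Type (max u w) := ⨁ s : Simplex X o k, stalk X o F s

/-- Simplicial `k`-cochains with local coefficients: the value at `⟨v₀, …, v_k⟩` lies in the stalk
at `v₀`. -/
abbrev LocalCochain (k : ℕ) : Type (max u w) := (s : Simplex X o k) → stalk X o F s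

open Classical in
/-- The boundary with local coefficients: `a s ↦ ∑ (-1)^i (transport of a) (i-th face of s)`. -/
def localBoundary (k : ℕ) : LocalChain X o F (k + 1) →ₗ[A] LocalChain X o F k :=
  DirectSum.toModule A _ _ fun s =>
    ∑ i : Fin (k + 2), (-1 : A) ^ (i : ℕ) •
      (DirectSum.lof A (Simplex X o k) (fun s' => stalk X o F s') (s.face i)).comp
        (transport X o F i s)

/-- The coboundary with local coefficients:
`(δ φ)(s) = ∑ (-1)^i (transport back to v₀ of φ (i-th face of s))`. -/
def localCoboundary (k : ℕ) : LocalCochain X o F k →ₗ[A] LocalCochain X o F (k + 1) :=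
  LinearMap.pi fun s =>
    ∑ i : Fin (k + 2), (-1 : A) ^ (i : ℕ) •
      (transportBack X o F i s).comp (LinearMap.proj (s.face i))

/-- Cycles with local coefficients. -/
def localCycles : (k : ℕ) → Submodule A (LocalChain X o F k)
  | 0 => ⊤
  | k + 1 => LinearMap.ker (localBoundary X o F k)

/-- The simplicial homology `H_i(X, F)` with coefficients in the local system `F`. -/
def LocalHomology (i : ℕ) : Type (max u w) :=
  Subquotient (localCycles X o F i) (LinearMap.range (localBoundary X o F i))

instance (i : ℕ) : AddCommGroup (LocalHomology X o F i) :=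
  inferInstanceAs (AddCommGroup (Subquotient (localCycles X o F i) (LinearMap.range (localBoundary X o F i))))

instance (i : ℕ) : Module A (LocalHomology X o F i) :=
  inferInstanceAs (Module A (Subquotient (localCycles X o F i) (LinearMap.range (localBoundary X o F i))))

/-- Coboundaries with local coefficients. -/
def localCoboundaries : (k : ℕ) → Submodule A (LocalCochain X o F k)
  | 0 => ⊥
  | k + 1 => LinearMap.range (localCoboundary X o F k)

/-- The simplicial cohomology `H^i(X, F)` with coefficients in the local system `F`. -/
def LocalCohomology (i : ℕ) : Type (max u w) :=
  Subquotient (LinearMap.ker (localCoboundary X o F i)) (localCoboundaries X o F i)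

instance (i : ℕ) : AddCommGroup (LocalCohomology X o F i) :=
  inferInstanceAs (AddCommGroup (Subquotient (LinearMap.ker (localCoboundary X o F i)) (localCoboundaries X o F i)))

instance (i : ℕ) : Module A (LocalCohomology X o F i) :=
  inferInstanceAs (Module A (Subquotient (LinearMap.ker (localCoboundary X o F i)) (localCoboundaries X o F i)))

end LocalCoefficients

/-! ### The local system of an infinite cyclic cover -/

section AlexanderLocalSystem

variable (K : Type v) [Field K] {Y : Type u} [TopologicalSpace Y] {x₀ : Y}
variable (ν : FundamentalGroup Y x₀ →* Multiplicative ℤ)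

/-- The stalk at `y` of the local system with monodromy `γ ↦ t ^ ν(γ)` on `R = K[t, t⁻¹]`:
families `φ` of elements of `R` indexed by homotopy classes of paths `p` from `x₀` to `y`, with
`φ (γ · p) = t ^ (-ν(γ)) φ(p)` for all loops `γ` at `x₀`. Evaluation at any `p` identifies it with
`R`. -/
def alexanderStalk (y : FundamentalGroupoid Y) :
    Submodule K[T;T⁻¹] ((FundamentalGroupoid.mk x₀ ⟶ y) → K[T;T⁻¹]) where
  carrier := {φ | ∀ (γ : FundamentalGroup Y x₀) (p : FundamentalGroupoid.mk x₀ ⟶ y),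
    φ (γ.toArrow ≫ p) = LaurentPolynomial.T (-(ν γ).toAdd) * φ p}
  add_mem' := by
    intro a b ha hb γ p
    simp only [Pi.add_apply, ha γ p, hb γ p, mul_add]
  zero_mem' := by
    intro γ p
    simp
  smul_mem' := by
    intro c a ha γ p
    simp only [Pi.smul_apply, smul_eq_mul, ha γ p]
    ring

/-- The local system `ℒ^ν` with stalk `R = K[t, t⁻¹]` on which a loop `γ` at `x₀` acts by
multiplication by `t ^ ν(γ)`. -/
def alexanderLocalSystem : LocalSystem.{u, v, max u v} K[T;T⁻¹] Y where
  obj y := ModuleCat.of K[T;T⁻¹] (alexanderStalk K ν y)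
  map {y z} q := ModuleCat.ofHom
    { toFun := fun φ => ⟨fun p => φ.1 (p ≫ inv q), fun γ p => by
        simpa only [Category.assoc] using φ.2 γ (p ≫ inv q)⟩
      map_add' := fun _ _ => rfl
      map_smul' := fun _ _ => rfl }
  map_id y := by
    refine ModuleCat.hom_ext (LinearMap.ext fun φ => Subtype.ext (funext fun p => ?_))
    simp
  map_comp q r := by
    refine ModuleCat.hom_ext (LinearMap.ext fun φ => Subtype.ext (funext fun p => ?_))
    simp

/-- `ℒ^ν ⊗_R A`, for a ring homomorphism `R → A`. -/
abbrev alexanderTensor {A : Type v} [CommRing A] (g : K[T;T⁻¹] →+* A) :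
    LocalSystem.{u, v, max u v} A Y :=
  alexanderLocalSystem K ν ⋙ ModuleCat.extendScalars.{v, v, max u v} g

/-- The element `s = t - 1` of `R`. -/
def sVar : K[T;T⁻¹] := LaurentPolynomial.T 1 - 1

/-- The truncation `R / (s ^ (m + 1))`. -/
abbrev Truncation (m : ℕ) : Type v := K[T;T⁻¹] ⧸ Ideal.span {sVar K ^ (m + 1)}

/-- The unit `t = 1 + s` of `K⟦s⟧`. -/
def tUnit : (PowerSeries K)ˣ :=
  IsUnit.unit (a := (1 + PowerSeries.X : PowerSeries K))
    (PowerSeries.isUnit_iff_constantCoeff.2 (by simp))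

/-- The completion map `R → R̂ = K⟦s⟧`, `t ↦ 1 + s`. -/
def toCompletion : K[T;T⁻¹] →+* PowerSeries K :=
  LaurentPolynomial.eval₂ PowerSeries.C (tUnit K)

end AlexanderLocalSystem

/-! ### Simplicial maps to the circle -/

section Circle

variable {V : Type u} [Fintype V] (X : AbstractSimplicialComplex V)

open Classical in
/-- The map `F : |X| → ℝ/ℤ` is simplicial, given on vertices by `f`, where `ℝ/ℤ` is triangulated by
the vertices `x_j = j/N` (`j` in `ℤ/N`) and the edges `[j/N, (j+1)/N]`: every simplex goes to a
vertex or an edge, and `F` is affine in barycentric coordinates. -/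
structure IsSimplicialCircleMap (N : ℕ) (f : V → ZMod N) (F : C(Realization X, UnitAddCircle)) :
    Prop where
  simplicial : ∀ σ ∈ X.faces, ∃ j : ZMod N, ∀ a ∈ σ, f a = j ∨ f a = j + 1
  affine : ∀ (x : Realization X) (j : ℕ), (∀ a, x.1 a ≠ 0 → f a = j ∨ f a = j + 1) →
    F x = (((j + ∑ a with f a = j + 1, x.1 a) / N : ℝ) : UnitAddCircle)

/-- The homomorphism `ν : π₁(Y, x₀) → ℤ` is induced by `F : Y → ℝ/ℤ`: for every loop `γ`, the
integer `ν(γ)` is the winding number of `F ∘ γ`, read off from a lift `θ` to `ℝ`. -/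
def IsInducedBy {Y : Type u} [TopologicalSpace Y] {x₀ : Y}
    (ν : FundamentalGroup Y x₀ →* Multiplicative ℤ) (F : C(Y, UnitAddCircle)) : Prop :=
  ∀ (γ : Path x₀ x₀) (θ : C(unitInterval, ℝ)), (∀ r, F (γ r) = (θ r : UnitAddCircle)) →
    θ 1 - θ 0 = (((ν (FundamentalGroup.fromPath (Path.Homotopic.Quotient.mk γ))).toAdd : ℤ) : ℝ)

/-- An orientation of each edge `{x_j, x_{j+1}}` of the triangulated circle. -/
def IsEdgeOrientation (N : ℕ) (o₀ : ZMod N → ZMod N → Prop) : Prop :=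
  ∀ j : ZMod N, Xor (o₀ j (j + 1)) (o₀ (j + 1) j)

/-- The vertex map `f` is weakly order preserving on every simplex. -/
def IsOrderPreserving (N : ℕ) (f : V → ZMod N) (o : V → V → Prop) (o₀ : ZMod N → ZMod N → Prop) :
    Prop :=
  ∀ σ ∈ X.faces, ∀ a ∈ σ, ∀ b ∈ σ, o a b → f a = f b ∨ o₀ (f a) (f b)

/-- The cochain `η₀` on the circle, on the pair `⟨x_i, x_j⟩`: it is `1` on the last edge
`[(N-1)/N, 1]` (`-1` if the edge is traversed backwards), and `0` on the other edges and on
degenerate pairs. Here `x_{N-1} = x_{-1}`. -/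
def circleCochain (K : Type v) [Field K] (N : ℕ) (i j : ZMod N) : K :=
  if i = -1 ∧ j = 0 then 1 else if i = 0 ∧ j = -1 then -1 else 0

variable {X}

/-- The pullback `η = f^* η₀`, a `1`-cochain on `X`. -/
def pullbackCochain (K : Type v) [Field K] {N : ℕ} (f : V → ZMod N) (o : V → V → Prop) :
    Cochain X o K 1 :=
  fun e => circleCochain K N (f (e.1 0)) (f (e.1 1))

end Circle

end TwistedComplex

end

/-! Every complex in sight is one complex with edge weights `c`: in the (co)boundary the zeroth face
of a simplex carries the factor `c v₀ v₁` and the other faces carry `1`. If `c a b * c b d = c a d`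
on ordered triangles, the usual cancellation gives square zero. The twisted complexes are the case
`c = 1 + s η`, because the cap or cup product with a 1-cochain only affects the zeroth face
(`nonempty_twistedHomology_equiv` and its dual). This weight is multiplicative: `η` is additive on a
simplex, since the simplex maps to one edge of the circle, and monotonicity forbids `η` from being
nonzero on two consecutive edges, so the quadratic term vanishes.

On the local side, join the base point to each vertex by a path. Since `ν` is onto, these paths can
be corrected by loops until transport along every edge is exactly `t ^ η`, not merely cohomologous
to it (`exists_paths_to_vertices`). So homology with local coefficients has weight `t ^ η`, and
cohomology, which transports backwards, has weight `t ^ (-η)`.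

On ordered edges `η` takes only the values `0` and `ε`, for one fixed sign `ε`. Hence `t ^ (±η) = 1
+ T η` for a power series `T` of order one in `s`, up to sign either `t - 1` or `1 - t⁻¹`
(`exists_powerSeries_zpow`). In general `T ≠ s`, but some automorphism of `K⟦s⟧` carries `T` to `s`;
it descends to every quotient and matches the two weights, giving a semilinear isomorphism on
(co)homology.

Linearity is recovered from the structure theorem: an automorphism of a discrete valuation ring
fixes every ideal, so twisting scalars by it does not change the isomorphism class of a finitely
generated module (`nonempty_semilinearEquiv_self`). The resulting linear isomorphism is not
canonical. The argument covers all quotients of `K⟦s⟧`, hence both the truncations and the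
completion. -/

noncomputable section

namespace TwistedComplex

/-! ### Semilinear automorphisms of modules over a discrete valuation ring -/

section DiscreteValuationRing

variable {P : Type v} [CommRing P] [IsDomain P] [IsDiscreteValuationRing P]
  {σ σ' : P →+* P} [RingHomInvPair σ σ'] [RingHomInvPair σ' σ]

/-- A ring automorphism with given inverse. -/
def ringEquivOfInvPair {A : Type*} [CommRing A] (σ σ' : A →+* A) [RingHomInvPair σ σ']
    [RingHomInvPair σ' σ] : A ≃+* A :=
  RingHomInvPair.toRingEquiv σ σ'

/-- An automorphism sends a uniformizer to an associate of itself, and every nonzero ideal is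
generated by a power of a uniformizer. -/
theorem map_mem_ideal_of_invPair {σ : P →+* P} (σ' : P →+* P) [RingHomInvPair σ σ']
    [RingHomInvPair σ' σ] (I : Ideal P) {x : P} (hx : x ∈ I) :
    σ x ∈ I := by
  obtain ⟨ϖ, hϖ⟩ := IsDiscreteValuationRing.exists_irreducible P
  by_cases hI : I = ⊥
  · subst hI
    simp_all
  obtain ⟨n, rfl⟩ := IsDiscreteValuationRing.ideal_eq_span_pow_irreducible hI hϖ
  obtain ⟨c, rfl⟩ := Ideal.mem_span_singleton'.1 hx
  have h : Irreducible (σ ϖ) := (MulEquiv.irreducible_iff (ringEquivOfInvPair σ σ')).2 hϖ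
  obtain ⟨u, hu⟩ := IsDiscreteValuationRing.associated_of_irreducible P hϖ h
  rw [map_mul, map_pow, ← hu]
  exact Ideal.mem_span_singleton'.2 ⟨σ c * u ^ n, by ring⟩

/-- A ring automorphism as a semilinear automorphism of the regular module. -/
def selfSemilinear {A : Type*} [CommRing A] (σ σ' : A →+* A) [RingHomInvPair σ σ']
    [RingHomInvPair σ' σ] : A ≃ₛₗ[σ] A :=
  { ringEquivOfInvPair σ σ' with
    map_smul' := fun a b => map_mul σ a b }

theorem map_selfSemilinear_ideal (I : Ideal P) :
    Submodule.map (selfSemilinear σ σ' : P →ₛₗ[σ] P) I = I := by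
  apply le_antisymm
  · rintro _ ⟨x, hx, rfl⟩
    exact map_mem_ideal_of_invPair σ' I hx
  · intro x hx
    exact ⟨σ' x, map_mem_ideal_of_invPair σ I hx, RingHomInvPair.comp_apply_eq₂⟩

/-- Over a discrete valuation ring, twisting the scalars by a ring automorphism does not change
the isomorphism class of a finitely generated module. -/
theorem nonempty_semilinearEquiv_self (σ σ' : P →+* P) [RingHomInvPair σ σ']
    [RingHomInvPair σ' σ] (M : Type w) [AddCommGroup M] [Module P M]
    [Module.Finite P M] : Nonempty (M ≃ₛₗ[σ] M) := by
  obtain ⟨n, ι, _, p, -, e, ⟨g⟩⟩ := Module.equiv_free_prod_directSum (R := P) (M := M)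
  let Q : ι → Type v := fun i => P ⧸ Submodule.span P {p i ^ e i}
  let a : (Fin n →₀ P) ≃+ (Fin n →₀ P) :=
    Finsupp.mapRange.addEquiv (selfSemilinear σ σ').toAddEquiv
  -- Each cyclic summand admits the twist because `σ` fixes the ideal that is divided out.
  let b : ∀ i, Q i ≃ₛₗ[σ] Q i := fun i =>
    Submodule.Quotient.equiv _ _ (selfSemilinear σ σ') (map_selfSemilinear_ideal _)
  let c : (⨁ i, Q i) ≃+ (⨁ i, Q i) := DFinsupp.mapRange.addEquiv fun i => (b i).toAddEquiv
  let d : ((Fin n →₀ P) × ⨁ i, Q i) ≃ₛₗ[σ] ((Fin n →₀ P) × ⨁ i, Q i) :=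
    { AddEquiv.prodCongr a c with
      map_smul' := by
        rintro r ⟨x, y⟩
        refine Prod.ext (Finsupp.ext fun i => ?_) (DFinsupp.ext fun i => ?_)
        · exact map_mul σ r (x i)
        · exact (b i).map_smulₛₗ r (y i) }
  exact ⟨(g.trans d).trans g.symm⟩

/-- A ring automorphism of a discrete valuation ring descends to all quotients, and twisting
scalars by the result does not change the isomorphism class of a finitely generated module. -/
theorem exists_invPair_of_surjective (σ σ' : P →+* P) [RingHomInvPair σ σ'] [RingHomInvPair σ' σ]
    {A : Type v} [CommRing A] (π : P →+* A) (hπ : Function.Surjective π) :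
    ∃ (τ τ' : A →+* A) (_ : RingHomInvPair τ τ') (_ : RingHomInvPair τ' τ),
      (∀ x, τ (π x) = π (σ x)) ∧
      ∀ (M : Type w) [AddCommGroup M] [Module A M] [Module.Finite A M],
        Nonempty (M ≃ₛₗ[τ'] M) := by
  have key : ∀ (α α' : P →+* P) [RingHomInvPair α α'] [RingHomInvPair α' α],
      ∃ β : A →+* A, ∀ x, β (π x) = π (α x) := fun α α' _ _ =>
    ⟨RingHom.liftOfSurjective π hπ ⟨π.comp α, fun x hx =>
      map_mem_ideal_of_invPair α' (RingHom.ker π) hx⟩,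
      fun x => RingHom.liftOfRightInverse_comp_apply _ _ _ _ x⟩
  obtain ⟨τ, hτ⟩ := key σ σ'
  obtain ⟨τ', hτ'⟩ := key σ' σ
  have h1 : RingHomInvPair τ τ' := by
    constructor <;> ext a <;> obtain ⟨x, rfl⟩ := hπ a
    · simp [hτ, hτ']
    · simp [hτ, hτ']
  have h2 : RingHomInvPair τ' τ := ⟨h1.comp_eq₂, h1.comp_eq⟩
  refine ⟨τ, τ', h1, h2, hτ, fun M _ _ _ => ?_⟩
  let _ : Module P M := Module.compHom M π
  have hfin : Module.Finite P M := by
    obtain ⟨S, hS⟩ := (inferInstance : Module.Finite A M)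
    refine ⟨S, eq_top_iff.2 fun x _ => ?_⟩
    have hx : x ∈ Submodule.span A (S : Set M) := hS ▸ Submodule.mem_top
    induction hx using Submodule.span_induction with
    | mem x h => exact Submodule.subset_span h
    | zero => exact zero_mem _
    | add x y _ _ hx hy => exact add_mem (hx trivial) (hy trivial)
    | smul a x _ hx =>
      obtain ⟨r, rfl⟩ := hπ a
      exact Submodule.smul_mem _ r (hx trivial)
  -- The twist is by the inverse, so that following the result with a `τ`-semilinear map gives a
  -- linear one.
  obtain ⟨e⟩ := nonempty_semilinearEquiv_self σ' σ M
  exact ⟨{ e with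
    map_smul' := fun a x => by
      obtain ⟨r, rfl⟩ := hπ a
      rw [hτ']
      exact e.map_smulₛₗ r x }⟩

end DiscreteValuationRing

/-! ### Automorphisms of power series rings -/

section PowerSeries

variable (K : Type v) [Field K]

/-- A power series of order one is carried to the variable by an automorphism. -/
theorem exists_invPair_map_eq_X (T : PowerSeries K) (h0 : PowerSeries.constantCoeff T = 0)
    (h1 : PowerSeries.coeff 1 T ≠ 0) :
    ∃ (σ σ' : PowerSeries K →+* PowerSeries K) (_ : RingHomInvPair σ σ')
      (_ : RingHomInvPair σ' σ), σ T = PowerSeries.X := by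
  have hu : IsUnit (PowerSeries.coeff 1 T) := isUnit_iff_ne_zero.2 h1
  have hT : PowerSeries.HasSubst T := PowerSeries.HasSubst.of_constantCoeff_zero' h0
  have hS : PowerSeries.HasSubst (T.substInvOfIsUnit hu) :=
    PowerSeries.HasSubst.substInvOfIsUnit T hu
  have e1 := PowerSeries.subst_substInvOfIsUnit_right T h0 hu
  have e2 := PowerSeries.subst_substInvOfIsUnit_left T h0 hu
  -- Substituting the compositional inverse of `T` sends `T` to the variable; substituting `T` is
  -- the inverse automorphism.
  let a : PowerSeries K →ₐ[K] PowerSeries K := PowerSeries.substAlgHom hS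
  let b : PowerSeries K →ₐ[K] PowerSeries K := PowerSeries.substAlgHom hT
  have ha : ∀ x, a x = x.subst (T.substInvOfIsUnit hu) := fun x =>
    congrFun (PowerSeries.coe_substAlgHom hS) x
  have hb : ∀ x, b x = x.subst T := fun x => congrFun (PowerSeries.coe_substAlgHom hT) x
  have hab : ∀ x, b (a x) = x := fun x => by
    rw [ha, hb, PowerSeries.subst_comp_subst_apply hS hT, e2, PowerSeries.X_subst]
  have hba : ∀ x, a (b x) = x := fun x => by
    rw [ha, hb, PowerSeries.subst_comp_subst_apply hT hS, e1, PowerSeries.X_subst]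
  exact ⟨a, b, ⟨RingHom.ext hab, RingHom.ext hba⟩, ⟨RingHom.ext hba, RingHom.ext hab⟩,
    (ha T).trans e1⟩

/-- Power series can be evaluated at nilpotent elements. -/
theorem exists_ringHom_of_pow_eq_zero {A : Type w} [CommRing A] [Algebra K A] (s : A) (n : ℕ)
    (hs : s ^ n = 0) : ∃ π : PowerSeries K →+* A, ∀ p : Polynomial K,
      π p = Polynomial.aeval s p := by
  -- Since `s ^ n = 0`, the value of a polynomial at `s` depends only on its class modulo `X ^ n`.
  -- Evaluating the truncation is therefore multiplicative.
  have key : ∀ p q : Polynomial K, (PowerSeries.X : PowerSeries K) ^ n ∣ (p : PowerSeries K) - q →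
      Polynomial.aeval s p = Polynomial.aeval s q := by
    intro p q h
    rw [← sub_eq_zero, ← map_sub]
    have h' : (Polynomial.X : Polynomial K) ^ n ∣ p - q := by
      rw [Polynomial.X_pow_dvd_iff]
      rw [PowerSeries.X_pow_dvd_iff] at h
      intro d hd
      simpa using h d hd
    obtain ⟨r, hr⟩ := h'
    simp [hr, hs]
  have htr : ∀ f : PowerSeries K,
      (PowerSeries.X : PowerSeries K) ^ n ∣ (PowerSeries.trunc n f : PowerSeries K) - f := by
    intro f
    rw [PowerSeries.X_pow_dvd_iff]
    intro d hd
    simp [PowerSeries.coeff_trunc, hd]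
  refine ⟨{ toFun := fun f => Polynomial.aeval s (PowerSeries.trunc n f)
            map_one' := ?_, map_mul' := ?_, map_zero' := ?_, map_add' := ?_ }, ?_⟩
  · rw [key _ 1, map_one]
    simpa using htr 1
  · intro f g
    rw [key _ (PowerSeries.trunc n f * PowerSeries.trunc n g), map_mul]
    have h := dvd_sub (htr (f * g)) (dvd_add ((htr f).mul_right (PowerSeries.trunc n g))
      ((htr g).mul_left f))
    convert h using 1
    push_cast
    ring
  · simp
  · intro f g
    simp
  · intro p
    exact key _ _ (htr p)

end PowerSeries

/-! ### Homology of sequences of linear maps -/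

section Sequences

variable {A : Type v} [CommRing A] {σ σ' : A →+* A} [RingHomInvPair σ σ'] [RingHomInvPair σ' σ]

/-- A semilinear equivalence matching cycles and boundaries induces one on homology. -/
def subquotientEquiv {M : Type*} {M' : Type*} [AddCommGroup M] [Module A M] [AddCommGroup M']
    [Module A M'] (e : M ≃ₛₗ[σ] M') {Z B : Submodule A M} {Z' B' : Submodule A M'}
    (hZ : ∀ x, e x ∈ Z' ↔ x ∈ Z) (hB : ∀ x, e x ∈ B' ↔ x ∈ B) :
    Subquotient Z B ≃ₛₗ[σ] Subquotient Z' B' :=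
  have hZm : Z.map (e : M →ₛₗ[σ] M') = Z' := by
    ext y
    obtain ⟨x, rfl⟩ := e.surjective y
    rw [hZ]
    exact ⟨fun ⟨z, hz, h⟩ => e.injective h ▸ hz, fun h => ⟨x, h, rfl⟩⟩
  Submodule.Quotient.equiv _ _ (e.ofSubmodules Z Z' hZm) (by
    ext ⟨y, hy⟩
    constructor
    · rintro ⟨⟨x, hx⟩, hxB, h⟩
      obtain rfl : e x = y := congrArg Subtype.val h
      exact (hB x).2 hxB
    · intro h
      obtain ⟨x, rfl⟩ := e.surjective y
      exact ⟨⟨x, (hZ x).1 hy⟩, (hB x).1 h, rfl⟩)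

variable {M M' : ℕ → Type*} [∀ k, AddCommGroup (M k)] [∀ k, Module A (M k)]
  [∀ k, AddCommGroup (M' k)] [∀ k, Module A (M' k)]

/-- Cycles of a sequence of maps lowering the degree. -/
def cyclesOf (d : ∀ k, M (k + 1) →ₗ[A] M k) : ∀ k, Submodule A (M k)
  | 0 => ⊤
  | k + 1 => LinearMap.ker (d k)

/-- Coboundaries of a sequence of maps raising the degree. -/
def coboundariesOf (d : ∀ k, M k →ₗ[A] M (k + 1)) : ∀ k, Submodule A (M k)
  | 0 => ⊥
  | k + 1 => LinearMap.range (d k)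

/-- The homology of a sequence of maps lowering the degree. -/
abbrev HomologyOf (d : ∀ k, M (k + 1) →ₗ[A] M k) (i : ℕ) :=
  Subquotient (cyclesOf d i) (LinearMap.range (d i))

/-- The cohomology of a sequence of maps raising the degree. -/
abbrev CohomologyOf (d : ∀ k, M k →ₗ[A] M (k + 1)) (i : ℕ) :=
  Subquotient (LinearMap.ker (d i)) (coboundariesOf d i)

theorem mem_ker_semilinear_iff {N N' L L' : Type*} [AddCommGroup N] [AddCommGroup N']
    [AddCommGroup L] [AddCommGroup L'] [Module A N] [Module A N'] [Module A L] [Module A L']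
    (e : N ≃ₛₗ[σ] N') (f : L ≃ₛₗ[σ] L') (d : N →ₗ[A] L) (d' : N' →ₗ[A] L')
    (h : ∀ x, f (d x) = d' (e x)) (x : N) : e x ∈ LinearMap.ker d' ↔ x ∈ LinearMap.ker d := by
  rw [LinearMap.mem_ker, LinearMap.mem_ker, ← h]
  exact f.map_eq_zero_iff

theorem mem_range_semilinear_iff {N N' L L' : Type*} [AddCommGroup N] [AddCommGroup N']
    [AddCommGroup L] [AddCommGroup L'] [Module A N] [Module A N'] [Module A L] [Module A L']
    (e : N ≃ₛₗ[σ] N') (f : L ≃ₛₗ[σ] L') (d : N →ₗ[A] L) (d' : N' →ₗ[A] L')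
    (h : ∀ x, f (d x) = d' (e x)) (x : L) :
    f x ∈ LinearMap.range d' ↔ x ∈ LinearMap.range d := by
  constructor
  · rintro ⟨y, hy⟩
    obtain ⟨z, rfl⟩ := e.surjective y
    exact ⟨z, f.injective ((h z).trans hy)⟩
  · rintro ⟨z, rfl⟩
    exact ⟨e z, (h z).symm⟩

/-- Homology is invariant under semilinear isomorphisms. -/
def homologyOfEquiv {d : ∀ k, M (k + 1) →ₗ[A] M k} {d' : ∀ k, M' (k + 1) →ₗ[A] M' k}
    (e : ∀ k, M k ≃ₛₗ[σ] M' k) (h : ∀ k x, e k (d k x) = d' k (e (k + 1) x)) (i : ℕ) :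
    HomologyOf d i ≃ₛₗ[σ] HomologyOf d' i :=
  subquotientEquiv (e i)
    (by
      cases i with
      | zero => exact fun x => ⟨fun _ => trivial, fun _ => trivial⟩
      | succ k => exact mem_ker_semilinear_iff _ (e k) _ _ (h k))
    (mem_range_semilinear_iff (e (i + 1)) _ _ _ (h i))

/-- Cohomology is invariant under semilinear isomorphisms. -/
def cohomologyOfEquiv {d : ∀ k, M k →ₗ[A] M (k + 1)} {d' : ∀ k, M' k →ₗ[A] M' (k + 1)}
    (e : ∀ k, M k ≃ₛₗ[σ] M' k) (h : ∀ k x, e (k + 1) (d k x) = d' k (e k x)) (i : ℕ) :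
    CohomologyOf d i ≃ₛₗ[σ] CohomologyOf d' i :=
  subquotientEquiv (e i) (mem_ker_semilinear_iff _ (e (i + 1)) _ _ (h i))
    (by
      cases i with
      | zero => exact fun x => (e 0).map_eq_zero_iff
      | succ k => exact mem_range_semilinear_iff (e k) _ _ _ (h k))

end Sequences

/-! ### Chains with multiplicative edge weights -/

section Weighted

variable {V : Type u} {X : AbstractSimplicialComplex V} {o : V → V → Prop}

instance [Finite V] (k : ℕ) : Finite (Simplex X o k) :=
  inferInstanceAs (Finite {_s : Fin (k + 1) → V // _})

variable {A : Type v} [CommRing A] (c : V → V → A)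

/-- The factor with which the `i`-th face enters the boundary: the weight of the first edge if
`i = 0`, and `1` otherwise. -/
def faceWeight {k : ℕ} (i : Fin (k + 2)) (s : Simplex X o (k + 1)) : A :=
  if i = 0 then c (s.1 0) (s.1 1) else 1

/-- The boundary in which the zeroth face is weighted by the first edge. -/
def weightedBoundary (k : ℕ) : (Simplex X o (k + 1) →₀ A) →ₗ[A] (Simplex X o k →₀ A) :=
  Finsupp.linearCombination A fun s =>
    ∑ i : Fin (k + 2), (-1 : A) ^ (i : ℕ) • faceWeight c i s • Finsupp.single (s.face i) (1 : A)

/-- The coboundary in which the zeroth face is weighted by the first edge. -/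
def weightedCoboundary (k : ℕ) : (Simplex X o k → A) →ₗ[A] (Simplex X o (k + 1) → A) :=
  LinearMap.pi fun s =>
    ∑ i : Fin (k + 2), (-1 : A) ^ (i : ℕ) • faceWeight c i s • LinearMap.proj (s.face i)

variable (X o) in
/-- The homology of the weighted boundary. -/
abbrev WeightedHomology (i : ℕ) :=
  HomologyOf (M := fun k => Simplex X o k →₀ A) (weightedBoundary c) i

variable (X o) in
/-- The cohomology of the weighted coboundary. -/
abbrev WeightedCohomology (i : ℕ) :=
  CohomologyOf (M := fun k => Simplex X o k → A) (weightedCoboundary c) i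

theorem Simplex.face_face {k : ℕ} (s : Simplex X o (k + 2)) (i : Fin (k + 3)) (j : Fin (k + 2))
    (h : (i : ℕ) ≤ j) :
    (s.face i).face j = (s.face j.succ).face (i.castLT (h.trans_lt j.2)) := by
  apply Subtype.ext
  funext l
  refine congrArg s.1 (Fin.ext ?_)
  simp only [Fin.succAbove, Fin.lt_def, Fin.val_castSucc, Fin.val_succ, Fin.val_castLT]
  split_ifs <;> simp_all <;> omega

variable (X o) in
/-- Multiplicativity of edge weights along ordered triangles. -/
def IsMultiplicativeWeight : Prop :=
  ∀ a b d : V, (∃ σ ∈ X.faces, a ∈ σ ∧ b ∈ σ ∧ d ∈ σ) → o a b → o b d → c a b * c b d = c a d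

variable {c}

/-- The only case with content is `i = j = 0`: dropping `v₀` and then `v₁` collects the weights of
`v₀v₁` and `v₁v₂`, while dropping `v₁` and then `v₀` collects that of `v₀v₂`. Elsewhere both sides
are the same single weight, or `1`. -/
theorem faceWeight_mul_faceWeight (hc : IsMultiplicativeWeight X o c) {k : ℕ}
    (s : Simplex X o (k + 2)) (i : Fin (k + 3)) (j : Fin (k + 2)) (h : (i : ℕ) ≤ j) :
    faceWeight c i s * faceWeight c j (s.face i) =
      faceWeight c j.succ s *
        faceWeight c (i.castLT (h.trans_lt j.2)) (s.face j.succ) := by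
  rcases Fin.eq_zero_or_eq_succ i with rfl | ⟨i, rfl⟩
  · rcases Fin.eq_zero_or_eq_succ j with rfl | ⟨j, rfl⟩
    · have := hc (s.1 0) (s.1 1) (s.1 2) (s.2.1.imp fun _ h => ⟨h.1, h.2 _, h.2 _, h.2 _⟩)
        (s.2.2 _ _ (by simp)) (s.2.2 _ _ (by simp [Fin.lt_def, Nat.mod_eq_of_lt]))
      simpa [faceWeight, Simplex.face, Fin.succAbove, Fin.lt_def] using this
    · simp [faceWeight, Simplex.face, Fin.succAbove, Fin.lt_def]
  · have hj : j ≠ 0 := by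
      rintro rfl
      simp at h
    have hi : (i.succ.castLT (h.trans_lt j.2)) ≠ 0 := fun e => by
      simpa using congrArg Fin.val e
    simp [faceWeight, hj, hi]

/-- The double alternating sum over iterated faces vanishes. -/
theorem sum_faceWeight_smul_face_face (hc : IsMultiplicativeWeight X o c) {k : ℕ} {M : Type*}
    [AddCommGroup M] [Module A M] (φ : Simplex X o k → M) (s : Simplex X o (k + 2)) :
    ∑ i : Fin (k + 3), (-1 : A) ^ (i : ℕ) • faceWeight c i s •
      ∑ j : Fin (k + 2), (-1 : A) ^ (j : ℕ) • faceWeight c j (s.face i) •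
        φ ((s.face i).face j) = 0 := by
  simp only [Finset.smul_sum, ← Finset.sum_product']
  -- The pair `(i, j)` with `i ≤ j` cancels against `(j + 1, i)`: same iterated face, same weight,
  -- opposite sign.
  let S : Finset (Fin (k + 3) × Fin (k + 2)) := {ij | (ij.1 : ℕ) ≤ (ij.2 : ℕ)}
  rw [Finset.univ_product_univ, ← Finset.sum_add_sum_compl S, ← eq_neg_iff_add_eq_zero,
    ← Finset.sum_neg_distrib]
  let ψ : ∀ ij : Fin (k + 3) × Fin (k + 2), ij ∈ S → Fin (k + 3) × Fin (k + 2) := fun ij hij =>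
    (ij.2.succ, Fin.castLT ij.1 (lt_of_le_of_lt (Finset.mem_filter.mp hij).right ij.2.2))
  apply Finset.sum_bij ψ
  · intro ij hij
    simp_rw [S, ψ, Finset.compl_filter, Finset.mem_filter_univ, Fin.val_succ,
      Fin.val_castLT] at hij ⊢
    lia
  · rintro ⟨i, j⟩ hij ⟨i', j'⟩ hij' h
    rw [Prod.mk_inj] at h ⊢
    simp only [Fin.ext_iff, Fin.val_succ, Fin.val_castLT] at h ⊢
    lia
  · rintro ⟨i', j'⟩ hij'
    simp_rw [S, Finset.compl_filter, Finset.mem_filter_univ, not_le] at hij'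
    refine ⟨(Fin.castSucc j', i'.pred ?_), ?_, ?_⟩
    · rintro rfl
      simp at hij'
    · simpa [S] using Nat.le_sub_one_of_lt hij'
    · simp [ψ]
  · rintro ⟨i, j⟩ hij
    have h : (i : ℕ) ≤ j := (Finset.mem_filter.mp hij).right
    simp only [ψ, smul_smul, ← neg_smul]
    rw [Simplex.face_face s i j h]
    congr 1
    have := faceWeight_mul_faceWeight hc s i j h
    simp only [Fin.val_succ, Fin.val_castLT, pow_succ]
    linear_combination (-1 : A) ^ (i : ℕ) * (-1) ^ (j : ℕ) * this

theorem weightedBoundary_single (k : ℕ) (s : Simplex X o (k + 1)) :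
    weightedBoundary c k (Finsupp.single s 1) =
      ∑ i : Fin (k + 2), (-1 : A) ^ (i : ℕ) • faceWeight c i s •
        Finsupp.single (s.face i) (1 : A) := by
  simp [weightedBoundary]

theorem weightedCoboundary_apply (k : ℕ) (φ : Simplex X o k → A) (s : Simplex X o (k + 1)) :
    weightedCoboundary c k φ s =
      ∑ i : Fin (k + 2), (-1 : A) ^ (i : ℕ) • faceWeight c i s • φ (s.face i) := by
  simp [weightedCoboundary]

theorem weightedBoundary_comp (hc : IsMultiplicativeWeight X o c) (k : ℕ) :
    weightedBoundary (X := X) (o := o) c k ∘ₗ weightedBoundary c (k + 1) = 0 := by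
  refine Finsupp.lhom_ext' fun s => LinearMap.ext_ring ?_
  simp only [LinearMap.coe_comp, Function.comp_apply, Finsupp.lsingle_apply,
    weightedBoundary_single, map_sum, map_smul]
  exact sum_faceWeight_smul_face_face hc (fun s => Finsupp.single s (1 : A)) s

theorem weightedCoboundary_comp (hc : IsMultiplicativeWeight X o c) (k : ℕ) :
    weightedCoboundary (X := X) (o := o) c (k + 1) ∘ₗ weightedCoboundary c k = 0 := by
  refine LinearMap.ext fun φ => funext fun s => ?_
  simp only [LinearMap.coe_comp, Function.comp_apply, weightedCoboundary_apply]
  exact sum_faceWeight_smul_face_face hc φ s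

variable {σ σ' : A →+* A} [RingHomInvPair σ σ'] [RingHomInvPair σ' σ]

/-- Only first edges of ordered simplices ever contribute, so agreement of the weights is required
on ordered edges of `X` alone. This matters because `η` has constant sign only there. -/
theorem map_faceWeight {c' : V → V → A} (h : ∀ a b, o a b → (∃ τ ∈ X.faces, a ∈ τ ∧ b ∈ τ) →
    σ (c a b) = c' a b) {k : ℕ} (i : Fin (k + 2)) (s : Simplex X o (k + 1)) :
    σ (faceWeight c i s) = faceWeight c' i s := by
  unfold faceWeight
  split_ifs
  · exact h _ _ (s.2.2 _ _ (by simp)) (s.2.1.imp fun _ h => ⟨h.1, h.2 _, h.2 _⟩)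
  · exact map_one σ

/-- A ring automorphism carrying one weight to another induces a semilinear isomorphism of
weighted homology. -/
def weightedHomologyEquiv {c' : V → V → A}
    (h : ∀ a b, o a b → (∃ τ ∈ X.faces, a ∈ τ ∧ b ∈ τ) → σ (c a b) = c' a b) (i : ℕ) :
    WeightedHomology X o c i ≃ₛₗ[σ]
      WeightedHomology X o c' i :=
  homologyOfEquiv (M := fun k => Simplex X o k →₀ A) (M' := fun k => Simplex X o k →₀ A) (fun k =>
    { Finsupp.mapRange.addEquiv (ι := Simplex X o k) (selfSemilinear σ σ').toAddEquiv with
      map_smul' := fun r x => Finsupp.ext fun s => map_mul σ r (x s) })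
    (fun k x => by
      change Finsupp.mapRange.addMonoidHom (σ : A →+ A) (weightedBoundary c k x) =
        weightedBoundary c' k (Finsupp.mapRange.addMonoidHom (σ : A →+ A) x)
      induction x using Finsupp.induction_linear with
      | zero => simp only [map_zero]
      | add x y hx hy => simp only [map_add, hx, hy]
      | single s a =>
        simp only [weightedBoundary, Finsupp.linearCombination_single, Finset.smul_sum, map_sum,
          Finsupp.smul_single, Finsupp.mapRange.addMonoidHom_apply, Finsupp.mapRange_single,
          smul_eq_mul, mul_one, AddMonoidHom.coe_coe, map_mul, map_pow,
          map_neg, map_one, map_faceWeight h]) i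

/-- A ring automorphism carrying one weight to another induces a semilinear isomorphism of
weighted cohomology. -/
def weightedCohomologyEquiv {c' : V → V → A}
    (h : ∀ a b, o a b → (∃ τ ∈ X.faces, a ∈ τ ∧ b ∈ τ) → σ (c a b) = c' a b) (i : ℕ) :
    WeightedCohomology X o c i ≃ₛₗ[σ]
      WeightedCohomology X o c' i :=
  cohomologyOfEquiv (M := fun k => Simplex X o k → A) (M' := fun k => Simplex X o k → A) (fun k =>
    { AddEquiv.piCongrRight fun _ : Simplex X o k => (selfSemilinear σ σ').toAddEquiv with
      map_smul' := fun r x => funext fun s => map_mul σ r (x s) })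
    (fun k x => funext fun s => by
      change σ (weightedCoboundary c k x s) = weightedCoboundary c' k (fun t => σ (x t)) s
      simp [weightedCoboundary_apply, map_sum, map_faceWeight h]) i

end Weighted

/-! ### The twisted complexes as weighted complexes -/

section Twisted

variable {V : Type u} {X : AbstractSimplicialComplex V} {o : V → V → Prop}
  {K : Type v} [Field K]

/-- This is why the twist by a 1-cochain amounts to reweighting the zeroth face. -/
theorem Simplex.back_eq_face_zero {k : ℕ} (s : Simplex X o (k + 1)) :
    Simplex.back (q := k) (p := 1) s = s.face 0 :=
  Subtype.ext (funext fun _ => congrArg s.1 (by ext; simp))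

variable {A : Type v} [CommRing A] [Algebra K A] {η : Cochain X o K 1} {s : A} {c : V → V → A}

/-- Splitting an alternating sum with weights into the plain one and a correction. -/
theorem sum_faceWeight_smul {M : Type*} [AddCommGroup M] [Module A M]
    (h : ∀ e : Simplex X o 1, c (e.1 0) (e.1 1) = 1 + s * algebraMap K A (η e)) {k : ℕ}
    (t : Simplex X o (k + 1)) (φ : Fin (k + 2) → M) :
    ∑ i : Fin (k + 2), (-1 : A) ^ (i : ℕ) • faceWeight c i t • φ i =
      ∑ i : Fin (k + 2), (-1 : A) ^ (i : ℕ) • φ i +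
        s • algebraMap K A (η (Simplex.front (q := k) (p := 1) t)) • φ 0 := by
  have h0 : faceWeight c 0 t =
      1 + s * algebraMap K A (η (Simplex.front (q := k) (p := 1) t)) := by
    rw [← h]
    simp only [faceWeight, if_true, Simplex.front]
    congr 1
  rw [Fin.sum_univ_succ, Fin.sum_univ_succ (fun i => (-1 : A) ^ (i : ℕ) • φ i), h0]
  simp only [faceWeight, Fin.succ_ne_zero, if_false, one_smul, Fin.val_zero, pow_zero, add_smul,
    mul_smul]
  abel

variable (A) in
open Classical in
/-- Extension of scalars of chains. -/
def chainEquiv (k : ℕ) : A ⊗[K] Chain X o K k ≃ₗ[A] (Simplex X o k →₀ A) :=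
  TensorProduct.finsuppScalarRight K A A (Simplex X o k)

theorem chainEquiv_tmul_single (k : ℕ) (a : A) (t : Simplex X o k) (x : K) :
    chainEquiv A k (a ⊗ₜ[K] Finsupp.single t x) = Finsupp.single t (x • a) := by
  simp [chainEquiv, TensorProduct.finsuppScalarRight_apply_tmul]

theorem chainEquiv_twistedBoundary
    (h : ∀ e : Simplex X o 1, c (e.1 0) (e.1 1) = 1 + s * algebraMap K A (η e)) (k : ℕ)
    (x : A ⊗[K] Chain X o K (k + 1)) :
    chainEquiv A k (twistedBoundary η A s k x) =
      weightedBoundary c k (chainEquiv A (k + 1) x) := by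
  induction x using TensorProduct.induction_on with
  | zero => simp only [map_zero]
  | add x y hx hy => simp only [map_add, hx, hy]
  | tmul a x =>
    induction x using Finsupp.induction_linear with
    | zero => simp only [TensorProduct.tmul_zero, map_zero]
    | add x y hx hy => simp only [TensorProduct.tmul_add, map_add, hx, hy]
    | single t r =>
      have e : weightedBoundary c k (Finsupp.single t (r • a)) = _ :=
        (congrArg _ (by simp [Algebra.smul_def, mul_comm])).trans
          ((map_smul (weightedBoundary c k) (r • a) (Finsupp.single t 1)).trans
            (congrArg _ ((weightedBoundary_single k t).trans (sum_faceWeight_smul h t _))))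
      rw [chainEquiv_tmul_single, e]
      simp only [twistedBoundary, LinearMap.add_apply, LinearMap.smul_apply,
        LinearMap.baseChange_tmul, boundary, cap, Finsupp.linearCombination_single,
        Simplex.back_eq_face_zero, Finset.smul_sum, TensorProduct.tmul_sum, map_add, map_sum,
        map_smul, Finsupp.smul_single, chainEquiv_tmul_single, smul_add, smul_eq_mul, mul_one]
      congr 1
      · refine Finset.sum_congr rfl fun i _ => ?_
        congr 1
        simp only [Algebra.smul_def, map_mul, map_pow, map_neg, map_one]
        ring
      · congr 1
        simp only [Algebra.smul_def, map_mul]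
        ring

/-- No nilpotence or completeness of `A` is involved: multiplicativity of `1 + s η` is all that is
used, so this applies over the Laurent polynomials too. -/
theorem twistedBoundary_comp
    (h : ∀ e : Simplex X o 1, c (e.1 0) (e.1 1) = 1 + s * algebraMap K A (η e))
    (hc : IsMultiplicativeWeight X o c) (k : ℕ) :
    twistedBoundary η A s k ∘ₗ twistedBoundary η A s (k + 1) = 0 := by
  refine LinearMap.ext fun x => (chainEquiv A k).injective ?_
  rw [LinearMap.comp_apply, chainEquiv_twistedBoundary h, chainEquiv_twistedBoundary h]
  simpa using LinearMap.congr_fun (weightedBoundary_comp hc k) (chainEquiv A (k + 2) x)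

/-- Twisted homology is weighted homology. -/
theorem nonempty_twistedHomology_equiv
    (h : ∀ e : Simplex X o 1, c (e.1 0) (e.1 1) = 1 + s * algebraMap K A (η e)) (i : ℕ) :
    Nonempty (TwistedHomology η A s i ≃ₗ[A] WeightedHomology X o c i) := by
  have e : HomologyOf (M := fun k => A ⊗[K] Chain X o K k) (twistedBoundary η A s) i ≃ₗ[A]
      WeightedHomology X o c i :=
    homologyOfEquiv (M := fun k => A ⊗[K] Chain X o K k) (M' := fun k => Simplex X o k →₀ A)
      (chainEquiv A) (chainEquiv_twistedBoundary h) i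
  -- The two families of cycles are defined by separate recursions on the degree, so they agree
  -- definitionally only once the degree is split.
  cases i <;> exact ⟨e⟩

variable [Finite V]

variable (A) in
open Classical in
/-- Extension of scalars of cochains. -/
def cochainEquiv (k : ℕ) : A ⊗[K] Cochain X o K k ≃ₗ[A] (Simplex X o k → A) :=
  -- Finiteness of the set of simplices lets the tensor product commute with the product defining
  -- cochains.
  letI := Fintype.ofFinite (Simplex X o k)
  TensorProduct.piScalarRight K A A (Simplex X o k)

theorem cochainEquiv_tmul (k : ℕ) (a : A) (x : Cochain X o K k) (t : Simplex X o k) :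
    cochainEquiv A k (a ⊗ₜ[K] x) t = x t • a := by
  simp [cochainEquiv]

theorem cochainEquiv_twistedCoboundary
    (h : ∀ e : Simplex X o 1, c (e.1 0) (e.1 1) = 1 + s * algebraMap K A (η e)) (k : ℕ)
    (x : A ⊗[K] Cochain X o K k) :
    cochainEquiv A (k + 1) (twistedCoboundary η A s k x) =
      weightedCoboundary c k (cochainEquiv A k x) := by
  induction x using TensorProduct.induction_on with
  | zero => simp only [map_zero]
  | add x y hx hy => simp only [map_add, hx, hy]
  | tmul a x =>
    funext t
    rw [weightedCoboundary_apply, sum_faceWeight_smul h]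
    simp only [twistedCoboundary, LinearMap.add_apply, LinearMap.smul_apply,
      LinearMap.baseChange_tmul, map_add, map_smul, Pi.add_apply, Pi.smul_apply,
      cochainEquiv_tmul, coboundary, cup, LinearMap.pi_apply, LinearMap.coe_sum, Finset.sum_apply,
      Simplex.back_eq_face_zero, LinearMap.coe_proj, Function.eval, smul_eq_mul, Finset.sum_smul]
    congr 1
    · refine Finset.sum_congr rfl fun i _ => ?_
      simp only [Algebra.smul_def, map_mul, map_pow, map_neg, map_one]
      ring
    · simp only [Algebra.smul_def, map_mul]
      ring

theorem twistedCoboundary_comp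
    (h : ∀ e : Simplex X o 1, c (e.1 0) (e.1 1) = 1 + s * algebraMap K A (η e))
    (hc : IsMultiplicativeWeight X o c) (k : ℕ) :
    twistedCoboundary η A s (k + 1) ∘ₗ twistedCoboundary η A s k = 0 := by
  refine LinearMap.ext fun x => (cochainEquiv A (k + 2)).injective ?_
  rw [LinearMap.comp_apply, cochainEquiv_twistedCoboundary h, cochainEquiv_twistedCoboundary h]
  simpa using LinearMap.congr_fun (weightedCoboundary_comp hc k) (cochainEquiv A k x)

/-- Twisted cohomology is weighted cohomology. -/
theorem nonempty_twistedCohomology_equiv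
    (h : ∀ e : Simplex X o 1, c (e.1 0) (e.1 1) = 1 + s * algebraMap K A (η e)) (i : ℕ) :
    Nonempty (TwistedCohomology η A s i ≃ₗ[A] WeightedCohomology X o c i) := by
  have e : CohomologyOf (M := fun k => A ⊗[K] Cochain X o K k) (twistedCoboundary η A s) i ≃ₗ[A]
      WeightedCohomology X o c i :=
    cohomologyOfEquiv (M := fun k => A ⊗[K] Cochain X o K k) (M' := fun k => Simplex X o k → A)
      (cochainEquiv A) (cochainEquiv_twistedCoboundary h) i
  cases i <;> exact ⟨e⟩

end Twisted

/-! ### Local coefficients as weights -/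

section LocalWeights

variable {V : Type u} {X : AbstractSimplicialComplex V} {o : V → V → Prop}
  {A : Type v} [CommRing A] {c : V → V → A}

/-- Faces other than the zeroth keep the first vertex, so the normalization on constant edges makes
transport to them trivial. -/
theorem weight_eq_faceWeight (hc : ∀ a, c a a = 1) {k : ℕ} (i : Fin (k + 2))
    (s : Simplex X o (k + 1)) : c (s.1 0) ((s.face i).1 0) = faceWeight c i s := by
  rcases Fin.eq_zero_or_eq_succ i with rfl | ⟨j, rfl⟩
  · rfl
  · rw [faceWeight, if_neg (Fin.succ_ne_zero j), ← hc (s.1 0)]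
    simp [Simplex.face]

variable [Fintype V] {F : LocalSystem.{u, v, w} A (Realization X)}
  (e : ∀ a : V, F.obj ⟨vertex X a⟩ ≃ₗ[A] A)

open Classical in
/-- Trivialized stalks identify local chains with chains. -/
def localChainEquiv (k : ℕ) : LocalChain X o F k ≃ₗ[A] (Simplex X o k →₀ A) :=
  (DFinsupp.mapRange.linearEquiv fun s : Simplex X o k => e (s.1 0)).trans
    (finsuppLequivDFinsupp A).symm

open Classical in
theorem localChainEquiv_lof (k : ℕ) (s : Simplex X o k) (x : stalk X o F s) :
    localChainEquiv e k (DirectSum.lof A _ (fun s => stalk X o F s) s x) =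
      Finsupp.single s (e (s.1 0) x) := by
  refine (LinearEquiv.symm_apply_eq _).2 ?_
  refine (DFinsupp.mapRange_single (hf := fun s => map_zero (e (s.1 0)))).trans ?_
  exact (Finsupp.toDFinsupp_single s _).symm

open Classical in
theorem localChainEquiv_localBoundary (hc : ∀ a, c a a = 1)
    (h : ∀ (a b : V) (hab : ∃ σ ∈ X.faces, a ∈ σ ∧ b ∈ σ) (x : F.obj ⟨vertex X a⟩),
      e b ((F.map (X := ⟨vertex X a⟩) (Y := ⟨vertex X b⟩)
        (Path.Homotopic.Quotient.mk (segment X hab))).hom x) = c a b • e a x)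
    (k : ℕ) (x : LocalChain X o F (k + 1)) :
    localChainEquiv e k (localBoundary X o F k x) =
      weightedBoundary c k (localChainEquiv e (k + 1) x) := by
  induction x using DirectSum.induction_on with
  | zero => simp only [map_zero]
  | add x y hx hy => simp only [map_add, hx, hy]
  | of s x =>
    change localChainEquiv e k (localBoundary X o F k
      (DirectSum.lof A _ (fun s => stalk X o F s) s x)) = weightedBoundary c k
        (localChainEquiv e (k + 1) (DirectSum.lof A _ (fun s => stalk X o F s) s x))
    have hs : (Finsupp.single s (e (s.1 0) x) : Simplex X o (k + 1) →₀ A) =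
        e (s.1 0) x • Finsupp.single s 1 := by simp
    rw [localChainEquiv_lof, hs, map_smul, weightedBoundary_single, localBoundary,
      DirectSum.toModule_lof]
    simp only [LinearMap.coe_sum, Finset.sum_apply, LinearMap.smul_apply, LinearMap.comp_apply,
      map_sum, map_smul, localChainEquiv_lof, Finset.smul_sum]
    refine Finset.sum_congr rfl fun i _ => ?_
    have ht : e ((s.face i).1 0) (transport X o F i s x) = faceWeight c i s • e (s.1 0) x := by
      rw [← weight_eq_faceWeight hc]
      exact h _ _ _ x
    rw [ht]
    simp only [Finsupp.smul_single, smul_eq_mul]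
    congr 1
    ring

/-- Local homology is weighted homology, given trivializations of the stalks. -/
theorem nonempty_localHomology_equiv (hc : ∀ a, c a a = 1)
    (h : ∀ (a b : V) (hab : ∃ σ ∈ X.faces, a ∈ σ ∧ b ∈ σ) (x : F.obj ⟨vertex X a⟩),
      e b ((F.map (X := ⟨vertex X a⟩) (Y := ⟨vertex X b⟩)
        (Path.Homotopic.Quotient.mk (segment X hab))).hom x) = c a b • e a x) (i : ℕ) :
    Nonempty (LocalHomology X o F i ≃ₗ[A] WeightedHomology X o c i) := by
  have e : HomologyOf (M := fun k => LocalChain X o F k) (localBoundary X o F) i ≃ₗ[A]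
      WeightedHomology X o c i :=
    homologyOfEquiv (M := fun k => LocalChain X o F k) (M' := fun k => Simplex X o k →₀ A)
      (localChainEquiv e) (localChainEquiv_localBoundary e hc h) i
  cases i <;> exact ⟨e⟩

/-- Local cohomology is weighted cohomology, given trivializations of the stalks. -/
theorem nonempty_localCohomology_equiv (hc : ∀ a, c a a = 1)
    (h : ∀ (a b : V) (hab : ∃ σ ∈ X.faces, a ∈ σ ∧ b ∈ σ) (x : F.obj ⟨vertex X b⟩),
      e a ((F.map (X := ⟨vertex X b⟩) (Y := ⟨vertex X a⟩)
        (Path.Homotopic.Quotient.mk (segment X hab).symm)).hom x) = c a b • e b x) (i : ℕ) :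
    Nonempty (LocalCohomology X o F i ≃ₗ[A] WeightedCohomology X o c i) := by
  have e : CohomologyOf (M := fun k => LocalCochain X o F k) (localCoboundary X o F) i ≃ₗ[A]
      WeightedCohomology X o c i :=
    cohomologyOfEquiv (M := fun k => LocalCochain X o F k) (M' := fun k => Simplex X o k → A)
      (fun k => LinearEquiv.piCongrRight fun s : Simplex X o k => e (s.1 0))
      (fun k x => funext fun s => by
        rw [weightedCoboundary_apply]
        simp only [LinearEquiv.piCongrRight_apply, localCoboundary, LinearMap.pi_apply,
          LinearMap.coe_sum, Finset.sum_apply, LinearMap.smul_apply, LinearMap.comp_apply,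
          map_sum, map_smul, LinearMap.proj_apply]
        refine Finset.sum_congr rfl fun i _ => ?_
        congr 1
        rw [← weight_eq_faceWeight hc]
        exact h _ _ _ _) i
  cases i <;> exact ⟨e⟩

end LocalWeights

/-! ### Trivialization of a rank one local system along paths from a base point -/

section Trivialization

variable {A : Type v} [CommRing A] {Y : Type u} [TopologicalSpace Y]
  {F : LocalSystem.{u, v, w} A Y} {x₀ : Y}

/-- Multiplication of endomorphisms reverses the order of composition, which is harmless in the
commutative group `ℤ`. -/
theorem nu_comp {ν : FundamentalGroup Y x₀ →* Multiplicative ℤ}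
    (γ δ : FundamentalGroupoid.mk x₀ ⟶ FundamentalGroupoid.mk x₀) :
    (ν (γ ≫ δ : FundamentalGroup Y x₀)).toAdd = (ν γ).toAdd + (ν δ).toAdd := by
  rw [add_comm, ← toAdd_mul, ← map_mul, End.mul_def]

/-- The trivialization of a stalk by transport back to the base point. -/
def stalkEquiv (L : F.obj ⟨x₀⟩ ≃ₗ[A] A) {y : FundamentalGroupoid Y}
    (p : FundamentalGroupoid.mk x₀ ⟶ y) : F.obj y ≃ₗ[A] A :=
  (F.mapIso (asIso p)).toLinearEquiv.symm.trans L

/-- In the trivializations along `p` and `r`, transport along `q` is the monodromy of the closed-up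
loop `p · q · r⁻¹`. -/
theorem stalkEquiv_map {ν : FundamentalGroup Y x₀ →* Multiplicative ℤ} (t : Aˣ)
    (L : F.obj ⟨x₀⟩ ≃ₗ[A] A)
    (hF : ∀ (γ : FundamentalGroupoid.mk x₀ ⟶ FundamentalGroupoid.mk x₀) (x : F.obj ⟨x₀⟩),
      (F.map γ).hom x = ((t ^ (ν γ).toAdd : Aˣ) : A) • x)
    {y z : FundamentalGroupoid Y} (p : FundamentalGroupoid.mk x₀ ⟶ y)
    (r : FundamentalGroupoid.mk x₀ ⟶ z) (q : y ⟶ z) (x : F.obj y) :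
    stalkEquiv L r ((F.map q).hom x) =
      ((t ^ (ν (p ≫ q ≫ inv r : FundamentalGroup Y x₀)).toAdd : Aˣ) : A) •
        stalkEquiv L p x := by
  have h : F.map q ≫ F.map (inv r) = F.map (inv p) ≫ F.map (p ≫ q ≫ inv r) := by
    simp
  have h' := congrArg (fun f => L (f.hom x)) h
  simp only [ModuleCat.hom_comp, LinearMap.comp_apply, hF] at h'
  rw [map_smul] at h'
  have key : ∀ {y' : FundamentalGroupoid Y} (p' : FundamentalGroupoid.mk x₀ ⟶ y')
      (x' : F.obj y'), stalkEquiv L p' x' = L ((F.map (inv p')).hom x') := fun p' x' => rfl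
  rw [key, key]
  exact h'

end Trivialization

/-! ### The local system of an infinite cyclic cover -/

section Alexander

variable (K : Type v) [Field K] {Y : Type u} [TopologicalSpace Y] {x₀ : Y}
  (ν : FundamentalGroup Y x₀ →* Multiplicative ℤ)

theorem alexanderStalk_apply (φ : alexanderStalk K ν ⟨x₀⟩)
    (p : FundamentalGroupoid.mk x₀ ⟶ FundamentalGroupoid.mk x₀) :
    φ.1 p = LaurentPolynomial.T (-(ν p).toAdd) * φ.1 (𝟙 _) := by
  have h := φ.2 p (𝟙 _)
  rwa [Category.comp_id] at h

/-- Evaluation at the constant path. -/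
def alexanderStalkEquiv : alexanderStalk K ν ⟨x₀⟩ ≃ₗ[K[T;T⁻¹]] K[T;T⁻¹] where
  toFun φ := φ.1 (𝟙 _)
  map_add' _ _ := rfl
  map_smul' _ _ := rfl
  invFun r := ⟨fun p => LaurentPolynomial.T (-(ν p).toAdd) * r, fun γ p => by
    beta_reduce
    rw [nu_comp, neg_add, LaurentPolynomial.T_add, mul_assoc]⟩
  left_inv φ := Subtype.ext (funext fun p => (alexanderStalk_apply K ν φ p).symm)
  right_inv r := by
    have h : (ν (𝟙 (FundamentalGroupoid.mk x₀) : FundamentalGroup Y x₀)).toAdd = 0 := by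
      have := nu_comp (ν := ν) (𝟙 _) (𝟙 _)
      rw [Category.comp_id] at this
      linarith
    simp [h]

/-- Two signs cancel: transport precomposes with `γ⁻¹`, and the families in the stalk transform by
`t ^ (-ν)`. -/
theorem alexanderLocalSystem_map_loop
    (γ : FundamentalGroupoid.mk x₀ ⟶ FundamentalGroupoid.mk x₀) :
    (alexanderLocalSystem K ν).map γ =
      (LaurentPolynomial.T (ν γ).toAdd : K[T;T⁻¹]) • 𝟙 ((alexanderLocalSystem K ν).obj ⟨x₀⟩) := by
  refine ModuleCat.hom_ext (LinearMap.ext fun φ => Subtype.ext (funext fun p => ?_))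
  change φ.1 (p ≫ inv γ) = LaurentPolynomial.T (ν γ).toAdd * φ.1 p
  have h1 := nu_comp (ν := ν) (p ≫ inv γ) γ
  rw [Category.assoc, IsIso.inv_hom_id, Category.comp_id] at h1
  rw [alexanderStalk_apply K ν φ (p ≫ inv γ), alexanderStalk_apply K ν φ p, ← mul_assoc,
    ← LaurentPolynomial.T_add, h1]
  congr 2
  ring

variable {A : Type v} [CommRing A] (g : K[T;T⁻¹] →+* A)

/-- The stalk of `ℒ^ν ⊗ A` at the base point. -/
def alexanderTensorEquiv : (alexanderTensor K ν g).obj ⟨x₀⟩ ≃ₗ[A] A :=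
  letI := g.toAlgebra
  (TensorProduct.AlgebraTensorModule.congr (LinearEquiv.refl A A)
    (alexanderStalkEquiv K ν)).trans (TensorProduct.AlgebraTensorModule.rid K[T;T⁻¹] A A)

/-- The image of `t`. -/
def tImage : Aˣ :=
  MonoidHom.toHomUnits
    ({ toFun := fun n => g (LaurentPolynomial.T n.toAdd)
       map_one' := by simp
       map_mul' := fun m n => by rw [toAdd_mul, LaurentPolynomial.T_add, map_mul] } : Multiplicative ℤ →* A)
    (Multiplicative.ofAdd 1)

theorem tImage_zpow (n : ℤ) : ((tImage K g ^ n : Aˣ) : A) = g (LaurentPolynomial.T n) := by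
  rw [tImage, ← map_zpow, MonoidHom.coe_toHomUnits, ← ofAdd_zsmul]
  simp

theorem extendScalars_map_smul_id {R : Type v} [CommRing R] (g : R →+* A)
    (M : ModuleCat.{max u v} R) (r : R) :
    (ModuleCat.extendScalars.{v, v, max u v} g).map (r • 𝟙 M) =
      g r • 𝟙 ((ModuleCat.extendScalars.{v, v, max u v} g).obj M) := by
  refine ModuleCat.ExtendScalars.hom_ext fun m => ?_
  let _ := g.toAlgebra
  have h : (1 : A) ⊗ₜ[R] (r • m) = (g r * 1 : A) ⊗ₜ[R] m :=
    (TensorProduct.tmul_smul r (1 : A) m).trans (TensorProduct.smul_tmul' r (1 : A) m)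
  exact h

theorem alexanderTensor_map_loop
    (γ : FundamentalGroupoid.mk x₀ ⟶ FundamentalGroupoid.mk x₀)
    (x : (alexanderTensor K ν g).obj ⟨x₀⟩) :
    ((alexanderTensor K ν g).map γ).hom x =
      ((tImage K g ^ (ν γ).toAdd : Aˣ) : A) • x := by
  have h : (alexanderTensor K ν g).map γ = g (LaurentPolynomial.T (ν γ).toAdd) • 𝟙 _ := by
    rw [Functor.comp_map, alexanderLocalSystem_map_loop]
    exact extendScalars_map_smul_id g _ _
  rw [tImage_zpow, h]
  rfl

end Alexander

/-! ### Path connectedness of the realization -/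

section PathConnected

variable {V : Type u} [Fintype V] {X : AbstractSimplicialComplex V}

/-- Points of a common simplex are joined by a straight path. -/
theorem joined_of_support_subset {x y : Realization X}
    (h : ∃ σ ∈ X.faces, ∀ v, (x.1 v ≠ 0 → v ∈ σ) ∧ (y.1 v ≠ 0 → v ∈ σ)) : Joined x y := by
  refine ⟨⟨⟨fun t => ⟨fun v => (1 - (t : ℝ)) * x.1 v + t * y.1 v, fun v => ?_, ?_, ?_⟩, ?_⟩,
    ?_, ?_⟩⟩
  · exact add_nonneg (mul_nonneg (sub_nonneg.2 t.2.2) (x.2.1 v)) (mul_nonneg t.2.1 (y.2.1 v))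
  · rw [Finset.sum_add_distrib, ← Finset.mul_sum, ← Finset.mul_sum, x.2.2.1, y.2.2.1]
    ring
  · obtain ⟨σ, hσ, hs⟩ := h
    refine ⟨σ, hσ, fun v hv => ?_⟩
    by_contra hc
    have hx : x.1 v = 0 := not_not.1 (mt (hs v).1 hc)
    have hy : y.1 v = 0 := not_not.1 (mt (hs v).2 hc)
    simp [hx, hy] at hv
  · refine Continuous.subtype_mk ?_ _
    fun_prop
  · exact Subtype.ext (funext fun v => by simp)
  · exact Subtype.ext (funext fun v => by simp)

/-- The open star of the carrier of a point lies in its path component. -/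
theorem exists_isOpen_joined (x : Realization X) :
    ∃ U : Set (Realization X), IsOpen U ∧ x ∈ U ∧ ∀ y ∈ U, Joined x y := by
  refine ⟨⋂ v : V, {y | x.1 v ≠ 0 → y.1 v ≠ 0}, isOpen_iInter_of_finite fun v => ?_, ?_, ?_⟩
  · by_cases hv : x.1 v = 0
    · simp [hv]
    · have hc : Continuous fun y : Realization X => y.1 v :=
        (continuous_apply v).comp continuous_subtype_val
      simpa [hv] using isOpen_ne.preimage hc
  · simp
  · intro y hy
    rw [Set.mem_iInter] at hy
    obtain ⟨σ, hσ, hs⟩ := y.2.2.2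
    exact joined_of_support_subset ⟨σ, hσ, fun v => ⟨fun h => hs v (hy v h), hs v⟩⟩

/-- Path components are open, as each point has a neighbourhood joined to it, hence they are also
closed. -/
theorem joined_of_connectedSpace [ConnectedSpace (Realization X)] (x y : Realization X) :
    Joined x y := by
  have hclopen : IsClopen {z | Joined x z} := by
    constructor
    · rw [← isOpen_compl_iff, isOpen_iff_forall_mem_open]
      intro z hz
      obtain ⟨U, hU, hzU, hj⟩ := exists_isOpen_joined z
      exact ⟨U, fun w hw hxw => hz (Joined.trans hxw (hj w hw).symm), hU, hzU⟩
    · rw [isOpen_iff_forall_mem_open]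
      intro z hz
      obtain ⟨U, hU, hzU, hj⟩ := exists_isOpen_joined z
      exact ⟨U, fun w hw => Joined.trans hz (hj w hw), hU, hzU⟩
  have := hclopen.eq_univ ⟨x, Joined.refl x⟩
  exact Set.eq_univ_iff_forall.1 this y

end PathConnected

/-! ### Winding numbers from lifts -/

section Winding

variable {Y : Type u} [TopologicalSpace Y] {F : C(Y, UnitAddCircle)}

/-- `θ` is a lift to the line of the path `F ∘ p` in the circle. -/
def IsLift (F : C(Y, UnitAddCircle)) {y z : Y} (p : Path y z) {a b : ℝ} (θ : Path a b) : Prop :=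
  ∀ r, F (p r) = ((θ r : ℝ) : UnitAddCircle)

theorem IsLift.source {y z : Y} {p : Path y z} {a b : ℝ} {θ : Path a b} (h : IsLift F p θ) :
    F y = (a : UnitAddCircle) := by
  simpa using h 0

theorem IsLift.target {y z : Y} {p : Path y z} {a b : ℝ} {θ : Path a b} (h : IsLift F p θ) :
    F z = (b : UnitAddCircle) := by
  simpa using h 1

theorem IsLift.symm {y z : Y} {p : Path y z} {a b : ℝ} {θ : Path a b} (h : IsLift F p θ) :
    IsLift F p.symm θ.symm :=
  fun _ => h _

theorem IsLift.trans {x y z : Y} {p : Path x y} {q : Path y z} {a b c : ℝ} {θ : Path a b}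
    {ψ : Path b c} (h : IsLift F p θ) (h' : IsLift F q ψ) :
    IsLift F (p.trans q) (θ.trans ψ) := by
  intro r
  rw [Path.trans_apply, Path.trans_apply]
  split_ifs
  · exact h _
  · exact h' _

/-- Lifts can be translated to start at any prescribed lift of the source. -/
theorem IsLift.exists_shift {y z : Y} {p : Path y z} {a b a' : ℝ} {θ : Path a b}
    (h : IsLift F p θ) (ha' : F y = (a' : UnitAddCircle)) :
    ∃ ψ : Path a' (a' + b - a), IsLift F p ψ := by
  have h0 : ((a' - a : ℝ) : UnitAddCircle) = 0 := by
    rw [AddCircle.coe_sub, ← ha', ← h.source, sub_self]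
  refine ⟨(θ.map (continuous_add_const (a' - a))).cast (by ring) (by ring), fun r => ?_⟩
  rw [h r]
  simp [h0]

theorem exists_lift {y z : Y} (p : Path y z) {a : ℝ} (ha : F y = (a : UnitAddCircle)) :
    ∃ (b : ℝ) (θ : Path a b), IsLift F p θ := by
  obtain ⟨Γ, h1, h2⟩ := (AddCircle.isCoveringMap_coe (1 : ℝ)).exists_path_lifts
    (F.comp p.toContinuousMap) a (by simpa using ha)
  exact ⟨Γ 1, ⟨Γ, h2, rfl⟩, fun r => (congrFun h1 r).symm⟩

theorem inv_mk {y z : Y} (p : Path y z) :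
    inv (C := FundamentalGroupoid Y) (X := ⟨y⟩) (Y := ⟨z⟩) (Path.Homotopic.Quotient.mk p) =
      Path.Homotopic.Quotient.mk p.symm := by
  rw [← Groupoid.inv_eq_inv]
  rfl

/-- The winding number of a loop made of three paths with known lifts. -/
theorem IsInducedBy.nu_eq {x₀ : Y} {ν : FundamentalGroup Y x₀ →* Multiplicative ℤ}
    (hν : IsInducedBy ν F) {y z : Y} {p : Path x₀ y} {q : Path y z} {r : Path x₀ z}
    {a b c d a' b' : ℝ} {α : Path a b} {β : Path c d} {γ : Path a' b'} (hp : IsLift F p α)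
    (hq : IsLift F q β) (hr : IsLift F r γ) (n : ℤ)
    (hn : (b - a) + (d - c) - (b' - a') = n) :
    (ν (CategoryStruct.comp (obj := FundamentalGroupoid Y) (X := ⟨x₀⟩) (Y := ⟨y⟩) (Z := ⟨x₀⟩)
      (Path.Homotopic.Quotient.mk p)
      (CategoryStruct.comp (obj := FundamentalGroupoid Y) (X := ⟨y⟩) (Y := ⟨z⟩) (Z := ⟨x₀⟩)
        (Path.Homotopic.Quotient.mk q)
        (inv (C := FundamentalGroupoid Y) (X := ⟨x₀⟩) (Y := ⟨z⟩)
          (Path.Homotopic.Quotient.mk r))))).toAdd = n := by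
  rw [inv_mk]
  -- The given lifts need not fit end to end. Translating them makes them composable and leaves
  -- their increments unchanged.
  obtain ⟨β', hβ'⟩ := hq.exists_shift hp.target
  obtain ⟨γ', hγ'⟩ := hr.symm.exists_shift hβ'.target
  have h := hν (p.trans (q.trans r.symm)) (α.trans (β'.trans γ')).toContinuousMap
    (hp.trans (hβ'.trans hγ'))
  have h' : ((n : ℤ) : ℝ) = ((ν (FundamentalGroup.fromPath
      (Path.Homotopic.Quotient.mk (p.trans (q.trans r.symm))))).toAdd : ℤ) := by
    rw [← h, ← hn]
    simp
    ring
  exact (Int.cast_injective h').symm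

end Winding

/-! ### The edge cocycle -/

section EdgeCocycle

/-- The integer valued cochain `η₀` on the circle. -/
def circleInt (N : ℕ) (i j : ZMod N) : ℤ :=
  if i = -1 ∧ j = 0 then 1 else if i = 0 ∧ j = -1 then -1 else 0

theorem circleCochain_eq (K : Type v) [Field K] (N : ℕ) (i j : ZMod N) :
    circleCochain K N i j = (circleInt N i j : K) := by
  unfold circleCochain circleInt
  split_ifs <;> simp

theorem zmod_ne_add_one {N : ℕ} (hN : 3 ≤ N) (j : ZMod N) : j ≠ j + 1 := by
  intro h
  have : Fact (1 < N) := ⟨by omega⟩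
  exact one_ne_zero (left_eq_add.1 h)

/-- For `N = 2` the pair `(0, -1)` would also consist of the ends of the edge `[x₀, x₁]`, on which
`η₀` must vanish. -/
theorem zmod_neg_one_ne_one {N : ℕ} (hN : 3 ≤ N) : (-1 : ZMod N) ≠ 1 := by
  intro h
  have h2 : ((2 : ℕ) : ZMod N) = 0 := by
    push_cast
    linear_combination -h
  rw [ZMod.natCast_eq_zero_iff] at h2
  exact absurd (Nat.le_of_dvd (by norm_num) h2) (by omega)

open Classical in
/-- Along an edge of the circle the jump of the standard height is `N` times `η₀`. -/
theorem circleInt_mul_eq {N : ℕ} (hN : 3 ≤ N) {i k j : ZMod N} (hi : i = j ∨ i = j + 1)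
    (hk : k = j ∨ k = j + 1) :
    circleInt N i k * (N : ℤ) = (i.val - (if i = j + 1 then 1 else 0)) -
      (k.val - (if k = j + 1 then 1 else 0)) := by
  have : NeZero N := ⟨by omega⟩
  have h1 : (1 : ZMod N).val = 1 := ZMod.val_one'' (by omega)
  have hj := zmod_ne_add_one hN j
  have h10 := zmod_neg_one_ne_one hN
  -- Only on the last edge does the representative wrap around, from `N - 1` to `0`; on all others
  -- both sides are zero.
  by_cases hlast : j = -1
  · subst hlast
    have hv : ((-1 : ZMod N).val : ℤ) = N - 1 := by
      obtain ⟨n, rfl⟩ : ∃ n, N = n + 1 := ⟨N - 1, by omega⟩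
      rw [ZMod.val_neg_one]
      push_cast
      ring
    have h0 : (-1 : ZMod N) ≠ 0 := by simpa using hj
    have h0' : (0 : ZMod N) ≠ -1 := h0.symm
    rw [neg_add_cancel] at hi hk ⊢
    rcases hi with rfl | rfl <;> rcases hk with rfl | rfl <;>
      simp [circleInt, hv, h0, h0']
    ring
  · have hj1 : j + 1 ≠ 0 := fun h => hlast (eq_neg_of_add_eq_zero_left h)
    have hlt : j.val + (1 : ZMod N).val < N := by
      rw [h1]
      refine lt_of_le_of_ne (ZMod.val_lt j) fun h => hj1 ?_
      rw [← ZMod.natCast_zmod_val j, ← Nat.cast_one, ← Nat.cast_add, h, ZMod.natCast_self]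
    have hv : ((j + 1).val : ℤ) = j.val + 1 := by
      rw [ZMod.val_add_of_lt hlt, h1]
      push_cast
      rfl
    have hz : circleInt N i k = 0 := by
      unfold circleInt
      rw [if_neg, if_neg]
      · rintro ⟨rfl, rfl⟩
        rcases hk with h | h
        · exact hlast h.symm
        · rcases hi with h' | h'
          · subst h'
            simp at h
            exact h10 h
          · exact hj1 h'.symm
      · rintro ⟨rfl, rfl⟩
        rcases hi with h | h
        · exact hlast h.symm
        · rcases hk with h' | h'
          · subst h'
            simp at h
            exact h10 h
          · exact hj1 h'.symm
    rw [hz]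
    rcases hi with rfl | rfl <;> rcases hk with rfl | rfl <;> simp [hv, hj]

variable {V : Type u} [Fintype V] {X : AbstractSimplicialComplex V} {N : ℕ} {f : V → ZMod N}
  {F : C(Realization X, UnitAddCircle)}

open Classical in
/-- The lift of an edge path whose endpoints are sent to an edge of the circle. -/
theorem IsSimplicialCircleMap.exists_lift_segment (hF : IsSimplicialCircleMap X N f F) [NeZero N]
    {j : ZMod N} {a b : V} (hab : ∃ σ ∈ X.faces, a ∈ σ ∧ b ∈ σ) (ha : f a = j ∨ f a = j + 1)
    (hb : f b = j ∨ f b = j + 1) :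
    ∃ θ : Path (((j.val : ℝ) + if f a = j + 1 then 1 else 0) / N)
      (((j.val : ℝ) + if f b = j + 1 then 1 else 0) / N),
      IsLift F (segment X hab) θ := by
  refine ⟨⟨⟨fun t => ((j.val : ℝ) + ((1 - (t : ℝ)) * (if f a = j + 1 then 1 else 0) +
    t * (if f b = j + 1 then 1 else 0))) / N, by fun_prop⟩, by simp, by simp⟩, fun t => ?_⟩
  rw [hF.affine (segment X hab t) j.val]
  · congr 3
    · rw [ZMod.natCast_zmod_val]
      change ∑ v with f v = j + 1, ((1 - (t : ℝ)) * (Pi.single a 1 : V → ℝ) v +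
        t * (Pi.single b 1 : V → ℝ) v) = _
      rw [Finset.sum_add_distrib, ← Finset.mul_sum, ← Finset.mul_sum]
      simp
  · intro v hv
    rw [ZMod.natCast_zmod_val]
    change ((1 - (t : ℝ)) * (Pi.single a 1 : V → ℝ) v + t * (Pi.single b 1 : V → ℝ) v) ≠ 0 at hv
    by_cases h1 : v = a
    · exact h1 ▸ ha
    · by_cases h2 : v = b
      · exact h2 ▸ hb
      · simp [h1, h2] at hv

theorem IsSimplicialCircleMap.map_vertex (hF : IsSimplicialCircleMap X N f F) (hN : 3 ≤ N)
    (a : V) : F (vertex X a) = (((f a).val / N : ℝ) : UnitAddCircle) := by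
  have : NeZero N := ⟨by omega⟩
  obtain ⟨θ, hθ⟩ := hF.exists_lift_segment (j := f a)
    ⟨{a}, X.singleton_mem a, Finset.mem_singleton_self a, Finset.mem_singleton_self a⟩
    (Or.inl rfl) (Or.inl rfl)
  simpa [zmod_ne_add_one hN (f a)] using hθ.source

/-- Paths from the base point to the vertices such that, after closing up, the winding number of
each edge is its value under the pulled back cochain `η₀`. -/
theorem exists_paths_to_vertices [ConnectedSpace (Realization X)] {x₀ : Realization X}
    {ν : FundamentalGroup (Realization X) x₀ →* Multiplicative ℤ} (hν : Function.Surjective ν)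
    (hN : 3 ≤ N) (hF : IsSimplicialCircleMap X N f F) (hνF : IsInducedBy ν F) :
    ∃ p : ∀ a : V, FundamentalGroupoid.mk x₀ ⟶ ⟨vertex X a⟩,
      ∀ (a b : V) (hab : ∃ σ ∈ X.faces, a ∈ σ ∧ b ∈ σ),
        (ν (p a ≫ (show FundamentalGroupoid.mk (vertex X a) ⟶ FundamentalGroupoid.mk (vertex X b)
          from Path.Homotopic.Quotient.mk (segment X hab)) ≫ inv (p b) :
            FundamentalGroup (Realization X) x₀)).toAdd = circleInt N (f a) (f b) := by
  have : NeZero N := ⟨by omega⟩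
  have hN0 : (N : ℝ) ≠ 0 := Nat.cast_ne_zero.2 (NeZero.ne N)
  let P : ∀ a, Path x₀ (vertex X a) := fun a => (joined_of_connectedSpace x₀ (vertex X a)).somePath
  obtain ⟨h₀, hh₀⟩ := QuotientAddGroup.mk_surjective (F x₀)
  have hlift : ∀ a, ∃ (b : ℝ) (θ : Path h₀ b), IsLift F (P a) θ := fun a =>
    exists_lift (P a) hh₀.symm
  choose h θ hθ using hlift
  -- The integer `n a` is the defect between the end of the lifted path and the standard height of
  -- `f a`; a loop of winding number `-n a` put in front of the path removes it.
  have hn : ∀ a, ∃ n : ℤ, (n : ℝ) = h a - (f a).val / N := by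
    intro a
    have : ((h a - (f a).val / N : ℝ) : UnitAddCircle) = 0 := by
      rw [AddCircle.coe_sub, ← (hθ a).target, hF.map_vertex hN, sub_self]
    obtain ⟨n, hn⟩ := (AddCircle.coe_eq_zero_iff 1).1 this
    exact ⟨n, by simpa using hn⟩
  choose n hn using hn
  have hγ : ∀ a, ∃ γ : FundamentalGroupoid.mk x₀ ⟶ FundamentalGroupoid.mk x₀,
      (ν (γ : FundamentalGroup _ x₀)).toAdd = -n a := fun a => by
    obtain ⟨γ, hγ⟩ := hν (Multiplicative.ofAdd (-n a))
    exact ⟨γ, by rw [hγ]; rfl⟩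
  choose γ hγ using hγ
  let Q : ∀ a : V, FundamentalGroupoid.mk x₀ ⟶ ⟨vertex X a⟩ := fun a =>
    Path.Homotopic.Quotient.mk (P a)
  refine ⟨fun a => γ a ≫ Q a, fun a b hab => ?_⟩
  generalize hq : (show FundamentalGroupoid.mk (vertex X a) ⟶ FundamentalGroupoid.mk (vertex X b)
          from Path.Homotopic.Quotient.mk (segment X hab)) = q
  have hinv : (ν (inv (γ b) : FundamentalGroup _ x₀)).toAdd = n b := by
    have h1 := nu_comp (ν := ν) (γ b) (inv (γ b))
    have h2 := nu_comp (ν := ν) (𝟙 _) (𝟙 _)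
    rw [IsIso.hom_inv_id] at h1
    rw [Category.comp_id] at h2
    linarith [hγ b]
  -- Before the correction, transport differs from `η` by the coboundary of `n`.
  have hmain : (ν (Q a ≫ q ≫ inv (Q b) : FundamentalGroup _ x₀)).toAdd =
      circleInt N (f a) (f b) + n a - n b := by
    obtain ⟨σ, hσ, haσ, hbσ⟩ := hab
    obtain ⟨j, hj⟩ := hF.simplicial σ hσ
    obtain ⟨ψ, hψ⟩ := hF.exists_lift_segment ⟨σ, hσ, haσ, hbσ⟩ (hj a haσ) (hj b hbσ)
    rw [← hq]
    refine hνF.nu_eq (hθ a) hψ (hθ b) _ ?_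
    have hz := congrArg (Int.cast : ℤ → ℝ) (circleInt_mul_eq hN (hj a haσ) (hj b hbσ))
    push_cast at hz ⊢
    rw [hn a, hn b]
    field_simp
    linear_combination -hz
  have hsplit : (γ a ≫ Q a) ≫ q ≫ inv (γ b ≫ Q b) =
      γ a ≫ (Q a ≫ q ≫ inv (Q b)) ≫ inv (γ b) := by
    simp
  rw [hsplit, nu_comp, nu_comp, hγ, hmain, hinv]
  ring

end EdgeCocycle

/-! ### The comparison theorem -/

section Comparison

variable {V : Type u} {X : AbstractSimplicialComplex V} {N : ℕ} {f : V → ZMod N}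
  {o : V → V → Prop} {o₀ : ZMod N → ZMod N → Prop}

/-- The edge weight `1 + s η`. -/
def linearWeight (f : V → ZMod N) {A : Type v} [CommRing A] (s : A) (a b : V) : A :=
  1 + s * (circleInt N (f a) (f b) : A)

theorem linearWeight_eq {K : Type v} [Field K] {A : Type v} [CommRing A] [Algebra K A] (s : A)
    (e : Simplex X o 1) :
    linearWeight f s (e.1 0) (e.1 1) =
      1 + s * algebraMap K A (pullbackCochain (X := X) K f o e) := by
  rw [linearWeight, pullbackCochain, circleCochain_eq, map_intCast]

/-- Along ordered edges the pulled back cochain takes values of one sign. -/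
theorem exists_sign (hN : 3 ≤ N) (ho₀ : IsEdgeOrientation N o₀)
    (hfo : IsOrderPreserving X N f o o₀) :
    ∃ ε : ℤ, (ε = 1 ∨ ε = -1) ∧ ∀ a b, o a b → (∃ σ ∈ X.faces, a ∈ σ ∧ b ∈ σ) →
      circleInt N (f a) (f b) = 0 ∨ circleInt N (f a) (f b) = ε := by
  have h0 : (-1 : ZMod N) ≠ 0 := by simpa using zmod_ne_add_one hN (-1)
  have h := ho₀ (-1)
  rw [neg_add_cancel] at h
  rcases h with ⟨-, h⟩ | ⟨-, h⟩
  · refine ⟨1, Or.inl rfl, fun a b hab ⟨σ, hσ, ha, hb⟩ => ?_⟩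
    unfold circleInt
    split_ifs with h1 h2
    · exact Or.inr rfl
    · have h3 := hfo σ hσ a ha b hb hab
      rw [h2.1, h2.2] at h3
      exact (h3.elim h0.symm h).elim
    · exact Or.inl rfl
  · refine ⟨-1, Or.inr rfl, fun a b hab ⟨σ, hσ, ha, hb⟩ => ?_⟩
    unfold circleInt
    split_ifs with h1 h2
    · have h3 := hfo σ hσ a ha b hb hab
      rw [h1.1, h1.2] at h3
      exact (h3.elim h0 h).elim
    · exact Or.inr rfl
    · exact Or.inl rfl

/-- The product expands to `1 + s (η(ab) + η(bd)) + s² η(ab) η(bd)`. Additivity of `η` handles the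
linear term, and one of the two factors in the quadratic term is zero. -/
theorem isMultiplicativeWeight_linearWeight (hN : 3 ≤ N) (ho : IsVertexOrder X o)
    (hf : ∀ σ ∈ X.faces, ∃ j : ZMod N, ∀ a ∈ σ, f a = j ∨ f a = j + 1)
    (ho₀ : IsEdgeOrientation N o₀) (hfo : IsOrderPreserving X N f o o₀) {A : Type v} [CommRing A]
    (s : A) : IsMultiplicativeWeight X o (linearWeight f s) := by
  rintro a b d ⟨σ, hσ, ha, hb, hd⟩ hab hbd
  obtain ⟨ε, hε, hsign⟩ := exists_sign hN ho₀ hfo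
  obtain ⟨j, hj⟩ := hf σ hσ
  have h1 := hsign a b hab ⟨σ, hσ, ha, hb⟩
  have h2 := hsign b d hbd ⟨σ, hσ, hb, hd⟩
  have h3 := hsign a d (ho.trans σ hσ a ha b hb d hd hab hbd) ⟨σ, hσ, ha, hd⟩
  -- On vertices sent to one edge of the circle, `N η₀` is a difference of a function of the
  -- endpoints, hence additive.
  have hadd : circleInt N (f a) (f d) = circleInt N (f a) (f b) + circleInt N (f b) (f d) := by
    have hN0 : (N : ℤ) ≠ 0 := by omega
    refine mul_right_cancel₀ hN0 ?_
    rw [add_mul, circleInt_mul_eq hN (hj a ha) (hj d hd), circleInt_mul_eq hN (hj a ha) (hj b hb),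
      circleInt_mul_eq hN (hj b hb) (hj d hd)]
    ring
  unfold linearWeight
  rw [hadd]
  rcases h1 with h1 | h1
  · rw [h1]
    push_cast
    ring
  · have h2' : circleInt N (f b) (f d) = 0 := by omega
    rw [h2']
    push_cast
    ring

variable {K : Type v} [Field K] {A : Type v} [CommRing A]

theorem isNoetherianRing_of_powerSeries (π : PowerSeries K →+* A) (hπ : Function.Surjective π) :
    IsNoetherianRing A :=
  isNoetherianRing_of_surjective _ _ π hπ

/-- Weights `1 + τ η` and `1 + s η`, where `τ` is a power series of order one in `s`, have
isomorphic homology. -/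
theorem nonempty_weightedHomology_equiv [Finite V] (π : PowerSeries K →+* A)
    (hπ : Function.Surjective π) (T : PowerSeries K) (h0 : PowerSeries.constantCoeff T = 0)
    (h1 : PowerSeries.coeff 1 T ≠ 0) {c : V → V → A}
    (hc : ∀ a b, o a b → (∃ τ ∈ X.faces, a ∈ τ ∧ b ∈ τ) → c a b = linearWeight f (π T) a b)
    (i : ℕ) :
    Nonempty (WeightedHomology X o c i ≃ₗ[A]
      WeightedHomology X o (linearWeight f (π PowerSeries.X)) i) ∧
    Nonempty (WeightedCohomology X o c i ≃ₗ[A]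
      WeightedCohomology X o (linearWeight f (π PowerSeries.X)) i) := by
  obtain ⟨σ, σ', _, _, hσ⟩ := exists_invPair_map_eq_X K T h0 h1
  obtain ⟨τ, τ', _, _, hτ, hM⟩ := exists_invPair_of_surjective.{v, max u v} σ σ' π hπ
  -- Makes the subquotients of the finite free (co)chain modules finitely generated, as untwisting
  -- the scalars requires.
  have : IsNoetherianRing A := isNoetherianRing_of_powerSeries π hπ
  have hw : ∀ a b, o a b → (∃ τ ∈ X.faces, a ∈ τ ∧ b ∈ τ) →
      τ (c a b) = linearWeight f (π PowerSeries.X) a b := by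
    intro a b hab hX
    rw [hc a b hab hX, linearWeight, linearWeight, map_add, map_one, map_mul, map_intCast, hτ, hσ]
  constructor
  · obtain ⟨r⟩ := hM (WeightedHomology X o c i)
    exact ⟨r.trans (weightedHomologyEquiv (σ := τ) (σ' := τ') hw i)⟩
  · obtain ⟨r⟩ := hM (WeightedCohomology X o c i)
    exact ⟨r.trans (weightedCohomologyEquiv (σ := τ) (σ' := τ') hw i)⟩

/-- The image of `t ^ η`, with `η` of one sign, is linear in `η`. -/
theorem exists_powerSeries_zpow (π : PowerSeries K →+* A) (t : Aˣ)
    (ht : (t : A) = π (1 + PowerSeries.X)) (ε : ℤ) (hε : ε = 1 ∨ ε = -1) :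
    ∃ T : PowerSeries K, PowerSeries.constantCoeff T = 0 ∧ PowerSeries.coeff 1 T ≠ 0 ∧
      ∀ n : ℤ, n = 0 ∨ n = ε → ((t ^ n : Aˣ) : A) = 1 + π T * n := by
  rcases hε with rfl | rfl
  · refine ⟨PowerSeries.X, by simp, by simp, ?_⟩
    rintro n (rfl | rfl) <;> simp [ht]
  · let W : PowerSeries K := ((tUnit K)⁻¹ : (PowerSeries K)ˣ)
    have hW : W * (1 + PowerSeries.X) = 1 := Units.inv_mul (tUnit K)
    have hW0 : PowerSeries.constantCoeff W = 1 := by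
      simpa using congrArg PowerSeries.constantCoeff hW
    have hW1 : PowerSeries.coeff 1 W = -1 := by
      have h := congrArg (PowerSeries.coeff 1) hW
      rw [mul_add, mul_one, map_add, PowerSeries.coeff_succ_mul_X,
        PowerSeries.coeff_zero_eq_constantCoeff_apply, hW0, PowerSeries.coeff_one] at h
      exact eq_neg_of_add_eq_zero_left (by simpa using h)
    have hinv : ((t⁻¹ : Aˣ) : A) = π W := by
      refine Units.inv_eq_of_mul_eq_one_left ?_
      rw [ht, ← map_mul, hW, map_one]
    -- For sign `-1` the witness is `T = 1 - t⁻¹`, because `t⁻¹ = 1 + T * (-1)`; its linear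
    -- coefficient is `1`.
    refine ⟨1 - W, by simp [hW0], by simp [hW1, PowerSeries.coeff_one], ?_⟩
    rintro n (rfl | rfl) <;> simp [hinv]

/-- The comparison of local and twisted (co)homology over a quotient of `K⟦s⟧`. -/
theorem nonempty_local_equiv_twisted [Fintype V] [ConnectedSpace (Realization X)]
    {x₀ : Realization X} {ν : FundamentalGroup (Realization X) x₀ →* Multiplicative ℤ}
    (hν : Function.Surjective ν) (hN : 3 ≤ N) {F : C(Realization X, UnitAddCircle)}
    (hF : IsSimplicialCircleMap X N f F) (hνF : IsInducedBy ν F)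
    (ho₀ : IsEdgeOrientation N o₀) (hfo : IsOrderPreserving X N f o o₀) [Algebra K A]
    (π : PowerSeries K →+* A) (hπ : Function.Surjective π) (g : K[T;T⁻¹] →+* A)
    (hg : g (LaurentPolynomial.T 1) = π (1 + PowerSeries.X)) (i : ℕ) :
    Nonempty (LocalHomology X o (alexanderTensor K ν g) i ≃ₗ[A]
      TwistedHomology (pullbackCochain (X := X) K f o) A (π PowerSeries.X) i) ∧
    Nonempty (LocalCohomology X o (alexanderTensor K ν g) i ≃ₗ[A]
      TwistedCohomology (pullbackCochain (X := X) K f o) A (π PowerSeries.X) i) := by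
  obtain ⟨p, hp⟩ := exists_paths_to_vertices hν hN hF hνF
  obtain ⟨ε, hε, hsign⟩ := exists_sign (X := X) hN ho₀ hfo
  let t : Aˣ := tImage K g
  have ht : (t : A) = π (1 + PowerSeries.X) := by
    have := tImage_zpow K g 1
    rw [zpow_one] at this
    rw [this, hg]
  let e : ∀ a : V, (alexanderTensor K ν g).obj ⟨vertex X a⟩ ≃ₗ[A] A := fun a =>
    stalkEquiv (alexanderTensorEquiv K ν g) (p a)
  let n : V → V → ℤ := fun a b => circleInt N (f a) (f b)
  have hn : ∀ a, n a a = 0 := fun a => by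
    have h0 : (-1 : ZMod N) ≠ 0 := by simpa using zmod_ne_add_one hN (-1)
    simp only [n, circleInt]
    rw [if_neg, if_neg]
    · exact fun h => h0 (h.2.symm.trans h.1)
    · exact fun h => h0 (h.1.symm.trans h.2)
  have htrans : ∀ (a b : V) (hab : ∃ σ ∈ X.faces, a ∈ σ ∧ b ∈ σ)
      (x : (alexanderTensor K ν g).obj ⟨vertex X a⟩),
      e b (((alexanderTensor K ν g).map (X := ⟨vertex X a⟩) (Y := ⟨vertex X b⟩)
        (Path.Homotopic.Quotient.mk (segment X hab))).hom x) =
          ((t ^ n a b : Aˣ) : A) • e a x := by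
    intro a b hab x
    have h := stalkEquiv_map t (alexanderTensorEquiv K ν g) (alexanderTensor_map_loop K ν g) (p a)
      (p b) (Path.Homotopic.Quotient.mk (segment X hab)) x
    rwa [hp a b hab] at h
  have hback : ∀ (a b : V) (hab : ∃ σ ∈ X.faces, a ∈ σ ∧ b ∈ σ)
      (x : (alexanderTensor K ν g).obj ⟨vertex X b⟩),
      e a (((alexanderTensor K ν g).map (X := ⟨vertex X b⟩) (Y := ⟨vertex X a⟩)
        (Path.Homotopic.Quotient.mk (segment X hab).symm)).hom x) =
          ((t ^ (-n a b) : Aˣ) : A) • e b x := by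
    intro a b hab x
    -- Backward transport inverts forward transport, so its factor is the inverse power of `t`.
    rw [← inv_mk]
    set y := ((alexanderTensor K ν g).map (X := ⟨vertex X b⟩) (Y := ⟨vertex X a⟩)
      (inv (C := FundamentalGroupoid _) (X := ⟨vertex X a⟩) (Y := ⟨vertex X b⟩)
        (Path.Homotopic.Quotient.mk (segment X hab)))).hom x with hy
    have hyx : ((alexanderTensor K ν g).map (X := ⟨vertex X a⟩) (Y := ⟨vertex X b⟩)
        (Path.Homotopic.Quotient.mk (segment X hab))).hom y = x := by
      rw [hy, ← LinearMap.comp_apply, ← ModuleCat.hom_comp, ← Functor.map_comp,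
        IsIso.inv_hom_id, CategoryTheory.Functor.map_id]
      rfl
    have h := htrans a b hab y
    rw [hyx] at h
    rw [h, smul_smul, ← Units.val_mul, ← zpow_add, neg_add_cancel, zpow_zero, Units.val_one,
      one_smul]
  constructor
  · obtain ⟨T, h0, h1, hT⟩ := exists_powerSeries_zpow π t ht ε hε
    obtain ⟨e₁⟩ := nonempty_localHomology_equiv (o := o) (c := fun a b => ((t ^ n a b : Aˣ) : A)) e
      (fun a => by simp [hn]) htrans i
    obtain ⟨e₂⟩ := (nonempty_weightedHomology_equiv (X := X) (o := o) (f := f) π hπ T h0 h1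
      (fun a b hab hX => hT _ (hsign a b hab hX)) i).1
    obtain ⟨e₃⟩ := nonempty_twistedHomology_equiv (X := X) (o := o)
      (linearWeight_eq (f := f) (K := K) (π PowerSeries.X)) i
    exact ⟨(e₁.trans e₂).trans e₃.symm⟩
  · obtain ⟨T, h0, h1, hT⟩ := exists_powerSeries_zpow π t ht (-ε) (by omega)
    obtain ⟨e₁⟩ := nonempty_localCohomology_equiv (o := o)
      (c := fun a b => ((t ^ (-n a b) : Aˣ) : A)) e (fun a => by simp [hn]) hback i
    obtain ⟨e₂⟩ := (nonempty_weightedHomology_equiv (X := X) (o := o) (f := f) π hπ (-T)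
      (by simp [h0]) (by simpa using h1)
      (fun a b hab hX => (hT (-n a b) (by simpa [n, neg_inj] using hsign a b hab hX)).trans (by
        simp [linearWeight, n])) i).2
    obtain ⟨e₃⟩ := nonempty_twistedCohomology_equiv (X := X) (o := o)
      (linearWeight_eq (f := f) (K := K) (π PowerSeries.X)) i
    exact ⟨(e₁.trans e₂).trans e₃.symm⟩

end Comparison

/-! ### The truncations as quotients of the power series ring -/

section Truncation

variable (K : Type v) [Field K]

/-- The class of `s` is nilpotent, so power series can be evaluated at it. The image contains `K`,
`t = 1 + s` and `t⁻¹`, which generate the truncation. -/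
theorem exists_powerSeries_to_truncation (m : ℕ) :
    ∃ π : PowerSeries K →+* Truncation K m, Function.Surjective π ∧
      π PowerSeries.X = Ideal.Quotient.mk _ (sVar K) := by
  have hs : (Ideal.Quotient.mk (Ideal.span {sVar K ^ (m + 1)}) (sVar K)) ^ (m + 1) = 0 := by
    rw [← map_pow, Ideal.Quotient.eq_zero_iff_mem]
    exact Ideal.mem_span_singleton_self _
  obtain ⟨π, hπ⟩ := exists_ringHom_of_pow_eq_zero K (A := Truncation K m) _ _ hs
  have hX : π PowerSeries.X = Ideal.Quotient.mk _ (sVar K) := by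
    simpa using hπ Polynomial.X
  have hC : ∀ a : K, π (PowerSeries.C a) = Ideal.Quotient.mk _ (LaurentPolynomial.C a) := by
    intro a
    have := hπ (Polynomial.C a)
    rw [Polynomial.coe_C, Polynomial.aeval_C] at this
    exact this
  have ht : π (tUnit K : PowerSeries K) =
      Ideal.Quotient.mk (Ideal.span {sVar K ^ (m + 1)}) (LaurentPolynomial.T 1) := by
    change π (1 + PowerSeries.X) = _
    rw [map_add, map_one, hX]
    change 1 + Ideal.Quotient.mk _ (LaurentPolynomial.T 1 - 1) = _
    rw [map_sub, map_one]
    ring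
  -- Both sides are inverses of the class of `t`, hence equal.
  have hti : π ((tUnit K)⁻¹ : (PowerSeries K)ˣ) =
      Ideal.Quotient.mk (Ideal.span {sVar K ^ (m + 1)}) (LaurentPolynomial.T (-1)) := by
    have h1 : π ((tUnit K)⁻¹ : (PowerSeries K)ˣ) * π (tUnit K : PowerSeries K) = 1 := by
      rw [← map_mul, Units.inv_mul, map_one]
    have h2 : Ideal.Quotient.mk (Ideal.span {sVar K ^ (m + 1)}) (LaurentPolynomial.T (-1)) *
        Ideal.Quotient.mk (Ideal.span {sVar K ^ (m + 1)}) (LaurentPolynomial.T 1) = 1 := by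
      rw [← map_mul, ← LaurentPolynomial.T_add]
      simp
    rw [ht] at h1
    exact (isUnit_iff_exists_inv'.2 ⟨_, h2⟩).mul_right_cancel (h1.trans h2.symm)
  refine ⟨π, fun x => ?_, hX⟩
  obtain ⟨x, rfl⟩ := Ideal.Quotient.mk_surjective x
  change Ideal.Quotient.mk _ x ∈ π.range
  induction x using LaurentPolynomial.induction_on with
  | h_C a => exact ⟨_, hC a⟩
  | h_add hp hq => rw [map_add]; exact add_mem hp hq
  | h_C_mul_T n a h =>
    rw [LaurentPolynomial.T_add, ← mul_assoc, map_mul]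
    exact mul_mem h ⟨_, ht⟩
  | h_C_mul_T_Z n a h =>
    rw [sub_eq_add_neg, LaurentPolynomial.T_add, ← mul_assoc, map_mul]
    exact mul_mem h ⟨_, hti⟩

theorem toCompletion_T : toCompletion K (LaurentPolynomial.T 1) = 1 + PowerSeries.X := by
  rw [toCompletion, LaurentPolynomial.eval₂_T, zpow_one]
  rfl

end Truncation

end TwistedComplex

end

theorem proposition2p1 {V : Type u} [Fintype V] (X : AbstractSimplicialComplex V)
    [ConnectedSpace (TwistedComplex.Realization X)]
    (K : Type v) [Field K]
    (x₀ : TwistedComplex.Realization X)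
    (ν : FundamentalGroup (TwistedComplex.Realization X) x₀ →* Multiplicative ℤ)
    (hν : Function.Surjective ν)
    (N : ℕ) (hN : 3 ≤ N)
    (f : V → ZMod N) (fν : C(TwistedComplex.Realization X, UnitAddCircle))
    (hf : TwistedComplex.IsSimplicialCircleMap X N f fν)
    (hνf : TwistedComplex.IsInducedBy ν fν)
    (o : V → V → Prop) (ho : TwistedComplex.IsVertexOrder X o)
    (o₀ : ZMod N → ZMod N → Prop) (ho₀ : TwistedComplex.IsEdgeOrientation N o₀)
    (hfo : TwistedComplex.IsOrderPreserving X N f o o₀)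
    (η : TwistedComplex.Cochain X o K 1) (hη : η = TwistedComplex.pullbackCochain K f o) :
    -- the twisted differential squares to zero over `R`
    (∀ k : ℕ,
      TwistedComplex.twistedBoundary η K[T;T⁻¹] (TwistedComplex.sVar K) k ∘ₗ
        TwistedComplex.twistedBoundary η K[T;T⁻¹] (TwistedComplex.sVar K) (k + 1) = 0) ∧
    -- the truncated versions
    (∀ m : ℕ, 0 < m → ∀ s : TwistedComplex.Truncation K m,
      s = Ideal.Quotient.mk _ (TwistedComplex.sVar K) →
      (∀ k : ℕ,
        TwistedComplex.twistedBoundary η (TwistedComplex.Truncation K m) s k ∘ₗ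
          TwistedComplex.twistedBoundary η (TwistedComplex.Truncation K m) s (k + 1) = 0) ∧
      (∀ i : ℕ, Nonempty
        (TwistedComplex.LocalHomology X o
            (TwistedComplex.alexanderTensor K ν
              (algebraMap K[T;T⁻¹] (TwistedComplex.Truncation K m))) i
          ≃ₗ[TwistedComplex.Truncation K m]
          TwistedComplex.TwistedHomology η (TwistedComplex.Truncation K m) s i)) ∧
      (∀ k : ℕ,
        TwistedComplex.twistedCoboundary η (TwistedComplex.Truncation K m) s (k + 1) ∘ₗ
          TwistedComplex.twistedCoboundary η (TwistedComplex.Truncation K m) s k = 0) ∧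
      (∀ i : ℕ, Nonempty
        (TwistedComplex.LocalCohomology X o
            (TwistedComplex.alexanderTensor K ν
              (algebraMap K[T;T⁻¹] (TwistedComplex.Truncation K m))) i
          ≃ₗ[TwistedComplex.Truncation K m]
          TwistedComplex.TwistedCohomology η (TwistedComplex.Truncation K m) s i))) ∧
    -- the completed cohomology version, over `R̂ = K⟦s⟧`
    (∀ k : ℕ,
      TwistedComplex.twistedCoboundary η (PowerSeries K) PowerSeries.X (k + 1) ∘ₗ
        TwistedComplex.twistedCoboundary η (PowerSeries K) PowerSeries.X k = 0) ∧
    (∀ i : ℕ, Nonempty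
      (TwistedComplex.LocalCohomology X o
          (TwistedComplex.alexanderTensor K ν (TwistedComplex.toCompletion K)) i
        ≃ₗ[PowerSeries K]
        TwistedComplex.TwistedCohomology η (PowerSeries K) PowerSeries.X i)) := by
  subst hη
  have hw : ∀ {A : Type v} [CommRing A] (s : A),
      TwistedComplex.IsMultiplicativeWeight X o (TwistedComplex.linearWeight f s) := fun s =>
    TwistedComplex.isMultiplicativeWeight_linearWeight hN ho hf.simplicial ho₀ hfo s
  refine ⟨fun k => TwistedComplex.twistedBoundary_comp (TwistedComplex.linearWeight_eq _) (hw _) k,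
    fun m _ s hs => ?_,
    fun k => TwistedComplex.twistedCoboundary_comp (TwistedComplex.linearWeight_eq _) (hw _) k,
    -- The completion is the quotient of `K⟦s⟧` by zero, so the comparison is applied to the
    -- identity map.
    fun i => (TwistedComplex.nonempty_local_equiv_twisted hν hN hf hνf ho₀ hfo
      (RingHom.id (PowerSeries K)) Function.surjective_id (TwistedComplex.toCompletion K)
      (TwistedComplex.toCompletion_T K) i).2⟩
  obtain ⟨π, hπ, hX⟩ := TwistedComplex.exists_powerSeries_to_truncation K m
  have hg : algebraMap K[T;T⁻¹] (TwistedComplex.Truncation K m) (LaurentPolynomial.T 1) =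
      π (1 + PowerSeries.X) := by
    rw [map_add, map_one, hX, Ideal.Quotient.algebraMap_eq]
    change _ = 1 + Ideal.Quotient.mk _ (LaurentPolynomial.T 1 - 1)
    rw [map_sub, map_one]
    ring
  obtain rfl : s = π PowerSeries.X := hs.trans hX.symm
  have h := TwistedComplex.nonempty_local_equiv_twisted hν hN hf hνf ho₀ hfo π hπ
    (algebraMap K[T;T⁻¹] (TwistedComplex.Truncation K m)) hg
  exact ⟨fun k => TwistedComplex.twistedBoundary_comp (TwistedComplex.linearWeight_eq _) (hw _) k,
    fun i => (h i).1,
    fun k => TwistedComplex.twistedCoboundary_comp (TwistedComplex.linearWeight_eq _) (hw _) k,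
    fun i => (h i).2⟩
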